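/- **Setting.** Let $n_x,n_u,n_\phi\in\mathbb N$, $\theta_*\in\mathbb R^{n_x\times n_\phi}$, and let $\phi=(\phi^1,\dots,\phi^{n_\phi}):\mathbb R^{n_x}\times\mathbb R^{n_u}\to\mathbb R^{n_\phi}$ have real-analytic, linearly independent components. Let $\pi:\mathbb R^{n_x}\to\mathbb R^{n_u}$ be real-analytic and consider the closed-loop system $$x_0=0,\qquad u_t=\pi(x_t)+\eta_t,\qquad x_{t+1}=\theta_*\phi(x_t,u_t)+w_t .$$ Assume that * $(w_t)_{t\ge0}$ is i.i.d. and $(\eta_t)_{t\ge0}$ is i.i.d., the two sequences are independent of each other, both have zero mean and a covariance matrix $\succeq\sigma^2 I$ for some $\sigma>0$, $\|w_t\|_\infty\le w_{\max}$ and $\|\eta_t\|_\infty\le u_{\max}$ almost surely, and both laws are semi-continuous (no Lebesgue null set has probability one); * the bound $w_{\max}$ is tight: there is a function $q_w$ such that for all $\ell>0$, all coordinates $j$ and all $t$, $q_w(\ell)>0$, $\mathbb P(w_t^j+w_{\max}\le\ell)\ge q_w(\ell)$ and $\mathbb P(w_{\max}-w_t^j\le\ell)\ge q_w(\ell)$;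 * the closed-loop map $f(x,(w,\eta))=\theta_*\phi(x,\pi(x)+\eta)+w$ is locally input-to-state stable (LISS) with parameters $\rho_x>0$ and $\rho>0$, $\rho\ge\max(w_{\max},u_{\max})$: $f$ is continuous, $f(0,0)=0$, and there are $\gamma\in\mathcal K$, $\beta\in\mathcal{KL}$ such that every solution of $x_{t+1}=f(x_t,d_t)$ with $\|x_0\|_2\le\rho_x$ and $\sup_t\|d_t\|_\infty\le\rho$ satisfies $\|x_t\|_2\le\beta(\|x_0\|_2,t)+\gamma(\sup_t\|d_t\|_\infty)$ for all $t\ge0$. Let $\mathcal F_t=\sigma(w_0,\dots,w_{t-1},x_0,\dots,x_t,\pi(x_0),\dots,\pi(x_t),\eta_0,\dots,\eta_t)$. For $s>0$ and $p\in(0,1)$ say that the $(1,s^2I,p)$-BMSB condition holds if $(\phi(x_t,u_t))_{t\ge1}$ is adapted to the filtration $(\mathcal F_t)_{t\ge1}$ and, for all $v$ with $\|v\|_2=1$ and all $t\ge1$, $\mathbb P(|v^\top\phi(x_{t+1},u_{t+1})|\ge s\mid\mathcal F_t)\ge p$ almost surely. The set-membership estimate (SME) is $$\Theta_T=\bigcap_{t=0}^{T-1}\{\hat\theta:\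 \|x_{t+1}-\hat\theta\phi(x_t,u_t)\|_\infty\le w_{\max}\},$$ and $\operatorname{diam}$ is the diameter in the Frobenius norm, with value $\infty$ for unbounded sets. **Claim.** There are $s_\phi>0$ and $p_\phi\in(0,1)$ for which the $(1,s_\phi^2I,p_\phi)$-BMSB condition holds, and there is $b_\phi<\infty$ with $\|\phi(x_t,u_t)\|_2\le b_\phi$ almost surely for all $t\ge0$. For all such $s_\phi,p_\phi,b_\phi$, put $a_1=\frac{s_\phi p_\phi}4$, $a_2=\frac{64b_\phi^2}{s_\phi^2p_\phi^2}$, $a_3=\frac{p_\phi^2}8$, $a_4=\frac{16b_\phi\sqrt{n_x}}{s_\phi p_\phi}$. Then: 1. For all integers $T>m\ge1$ and all $\delta\in(0,1)$, $$\mathbb P\big(\operatorname{diam}(\Theta_T)>\delta\big)\le544\,\tfrac Tm\,n_\phi^{2.5}\log(a_2n_\phi)\,a_2^{n_\phi}e^{-a_3m}+544\,n_x^{2.5}n_\phi^{2.5}\log(a_4n_xn_\phi)\,a_4^{n_xn_\phi}\Big(1-q_w\big(\tfrac{a_1\delta}{4\sqrt{n_x}}\big)\Big)^{\lceil T/m\rceil}.$$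 2. Suppose that $q_w(\ell)=c_w\ell$ for some $c_w>0$ and all $0<\ell\le2w_{\max}$. Let $\epsilon>0$ and let $T\ge m\ge1$ be integers with $$m\ge\tfrac1{a_3}\Big(\log\tfrac T\epsilon+n_\phi\log a_2+2.5\log n_\phi+\log\log(a_2n_\phi)+\log544\Big).$$ Then, with probability at least $1-2\epsilon$, $$\operatorname{diam}(\Theta_T)\le C\,\frac{\sqrt{n_x}\log\frac1\epsilon+n_x^{1.5}n_\phi\log\frac{b_\phi n_x}{s_\phi p_\phi}}{c_ws_\phi p_\phi T},$$ where $C>0$ is an absolute constant (it depends on none of the above data). -/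

import Mathlib

open MeasureTheory ProbabilityTheory Filter Topology
open scoped NNReal ENNReal Matrix

/-- `ℝⁿ` with the Euclidean norm. -/
abbrev Vec (n : ℕ) : Type := EuclideanSpace ℝ (Fin n)

/-- The `ℓ_∞` norm of a vector of `ℝⁿ` (the sup norm of its coordinates). -/
noncomputable def linfNorm {n : ℕ} (v : Vec n) : ℝ := ‖(WithLp.ofLp v : Fin n → ℝ)‖

/-- The product `θ y ∈ ℝⁿ` of a matrix `θ ∈ ℝ^{n × k}` and a vector `y ∈ ℝᵏ`. -/
noncomputable def linResp {n k : ℕ} (θ : Matrix (Fin n) (Fin k) ℝ) (y : Vec k) : Vec n :=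
  WithLp.toLp 2 (θ *ᵥ WithLp.ofLp y)

/-! ### Noise assumptions -/

/-- A distribution is semi-continuous if it is not carried by a Lebesgue null set. -/
def IsSemicontinuousLaw {n : ℕ} (ν : Measure (Vec n)) : Prop :=
  ¬ ∃ E : Set (Vec n), volume E = 0 ∧ ν E = 1

/-- The covariance matrix of a random vector. -/
noncomputable def covMatrix {Ω : Type*} [MeasurableSpace Ω] (μ : Measure Ω) {n : ℕ}
    (X : Ω → Vec n) : Matrix (Fin n) (Fin n) ℝ :=
  Matrix.of fun i j => covariance (fun ω => X ω i) (fun ω => X ω j) μ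

/-- An i.i.d. sequence with a semi-continuous, centred law, whose covariance is at least `σ² I` for
some `σ > 0`, and which is bounded by `dmax` in the `ℓ_∞` norm almost surely. -/
structure IsBoundedIIDSemicontinuous {Ω : Type*} [MeasurableSpace Ω] (μ : Measure Ω) {n : ℕ}
    (d : ℕ → Ω → Vec n) (dmax : ℝ) : Prop where
  measurable : ∀ t, Measurable (d t)
  indep : iIndepFun d μ
  identDistrib : ∀ t, IdentDistrib (d t) (d 0) μ μ
  semicontinuous : ∀ t, IsSemicontinuousLaw (μ.map (d t))
  mean_zero : ∀ t, ∫ ω, d t ω ∂μ = 0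
  cov_pos : ∃ σ : ℝ, 0 < σ ∧
    ∀ t, (covMatrix μ (d t) - (σ ^ 2) • (1 : Matrix (Fin n) (Fin n) ℝ)).PosSemidef
  bounded : ∀ t, ∀ᵐ ω ∂μ, linfNorm (d t ω) ≤ dmax

/-- The bound `wmax` on the disturbances is tight, as quantified by the function `qw`. -/
def IsTightBound {Ω : Type*} [MeasurableSpace Ω] (μ : Measure Ω) {n : ℕ}
    (w : ℕ → Ω → Vec n) (wmax : ℝ) (qw : ℝ → ℝ) : Prop :=
  ∀ ℓ : ℝ, 0 < ℓ → 0 < qw ℓ ∧ ∀ (j : Fin n) (t : ℕ),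
    qw ℓ ≤ μ.real {ω | w t ω j + wmax ≤ ℓ} ∧ qw ℓ ≤ μ.real {ω | wmax - w t ω j ≤ ℓ}

/-! ### Local input-to-state stability -/

/-- Class `𝒦` functions. -/
structure IsClassK (γ : ℝ≥0 → ℝ≥0) : Prop where
  continuous : Continuous γ
  strictMono : StrictMono γ
  zero : γ 0 = 0

/-- Class `𝒦ℒ` functions. -/
structure IsClassKL (β : ℝ≥0 → ℝ≥0 → ℝ≥0) : Prop where
  classK : ∀ t, IsClassK fun r => β r t
  antitone : ∀ r, Antitone (β r)
  tendsto : ∀ r, Tendsto (β r) atTop (𝓝 0)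

/-- The system `x_{t+1} = f (x_t, d_t)` is locally input-to-state stable with parameters `ρx`, `ρ`.
The input `d_t` lives in `ι → ℝ`, whose norm is the `ℓ_∞` norm. -/
structure IsLISS {n : ℕ} {ι : Type*} [Fintype ι] (f : Vec n → (ι → ℝ) → Vec n)
    (ρx ρ : ℝ) : Prop where
  continuous : Continuous fun z : Vec n × (ι → ℝ) => f z.1 z.2
  map_zero : f 0 0 = 0
  ρx_pos : 0 < ρx
  ρ_pos : 0 < ρ
  stable : ∃ (γ : ℝ≥0 → ℝ≥0) (β : ℝ≥0 → ℝ≥0 → ℝ≥0), IsClassK γ ∧ IsClassKL β ∧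
    ∀ (x : ℕ → Vec n) (d : ℕ → ι → ℝ), (∀ t, x (t + 1) = f (x t) (d t)) →
      ‖x 0‖ ≤ ρx → (∀ t, ‖d t‖ ≤ ρ) →
        ∀ t : ℕ, ‖x t‖₊ ≤ β ‖x 0‖₊ (t : ℝ≥0) + γ (⨆ k, ‖d k‖₊)

/-! ### The closed-loop system -/

/-- The closed-loop map `(x, (w, η)) ↦ θ φ(x, π(x) + η) + w`; the disturbance `w` and the input
noise `η` are the two blocks of the joint input `d`. -/
noncomputable def closedLoopMap {nx nu nφ : ℕ} (θ : Matrix (Fin nx) (Fin nφ) ℝ)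
    (φ : Vec nx × Vec nu → Vec nφ) (π : Vec nx → Vec nu)
    (x : Vec nx) (d : Fin nx ⊕ Fin nu → ℝ) : Vec nx :=
  linResp θ (φ (x, π x + WithLp.toLp 2 fun i => d (Sum.inr i))) +
    WithLp.toLp 2 fun i => d (Sum.inl i)

/-- The features `φ(x_t, u_t)` along the closed loop `u_t = π(x_t) + η_t`. -/
def features {Ω : Type*} {nx nu nφ : ℕ} (φ : Vec nx × Vec nu → Vec nφ) (π : Vec nx → Vec nu)
    (η : ℕ → Ω → Vec nu) (x : ℕ → Ω → Vec nx) (t : ℕ) (ω : Ω) : Vec nφ :=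
  φ (x t ω, π (x t ω) + η t ω)

/-- The history `ℱ_t = σ(w_0, …, w_{t-1}, x_0, …, x_t, π(x_0), …, π(x_t), η_0, …, η_t)`. -/
@[reducible] def history {Ω : Type*} {nx nu : ℕ} (π : Vec nx → Vec nu) (w : ℕ → Ω → Vec nx)
    (η : ℕ → Ω → Vec nu) (x : ℕ → Ω → Vec nx) (t : ℕ) : MeasurableSpace Ω :=
  (⨆ k, ⨆ _ : k < t, MeasurableSpace.comap (w k) inferInstance) ⊔
  (⨆ k, ⨆ _ : k ≤ t, MeasurableSpace.comap (x k) inferInstance) ⊔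
  (⨆ k, ⨆ _ : k ≤ t, MeasurableSpace.comap (fun ω => π (x k ω)) inferInstance) ⊔
  (⨆ k, ⨆ _ : k ≤ t, MeasurableSpace.comap (η k) inferInstance)

/-- The standing assumptions on the closed-loop system
`x_{t+1} = θ φ(x_t, π(x_t) + η_t) + w_t`, `x_0 = 0`. -/
structure IsClosedLoopSystem {Ω : Type*} [MeasurableSpace Ω] (μ : Measure Ω) {nx nu nφ : ℕ}
    (θ : Matrix (Fin nx) (Fin nφ) ℝ) (φ : Vec nx × Vec nu → Vec nφ) (π : Vec nx → Vec nu)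
    (w : ℕ → Ω → Vec nx) (η : ℕ → Ω → Vec nu) (x : ℕ → Ω → Vec nx)
    (wmax umax ρx ρ : ℝ) (qw : ℝ → ℝ) : Prop where
  init : ∀ ω, x 0 ω = 0
  step : ∀ t ω, x (t + 1) ω = linResp θ (features φ π η x t ω) + w t ω
  features_analytic : ∀ i, AnalyticOnNhd ℝ (fun z => φ z i) Set.univ
  features_linearIndependent :
    LinearIndependent ℝ (fun (i : Fin nφ) (z : Vec nx × Vec nu) => φ z i)
  policy_analytic : AnalyticOnNhd ℝ π Set.univ
  disturbance : IsBoundedIIDSemicontinuous μ w wmax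
  inputNoise : IsBoundedIIDSemicontinuous μ η umax
  indep : IndepFun (fun ω t => w t ω) (fun ω t => η t ω) μ
  liss : IsLISS (closedLoopMap θ φ π) ρx ρ
  bound_le : max wmax umax ≤ ρ
  tight : IsTightBound μ w wmax qw

/-! ### Block martingale small-ball condition -/

/-- The process `(y_t)_{t ≥ 1}` is adapted to the filtration `(ℱ_t)_{t ≥ 1}` and satisfies the
`(k, Γ, p)`-block martingale small-ball condition. -/
structure IsBMSB {Ω : Type*} [mΩ : MeasurableSpace Ω] (μ : Measure Ω)
    (F : ℕ → MeasurableSpace Ω) {n : ℕ} (y : ℕ → Ω → Vec n)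
    (k : ℕ) (Γ : Matrix (Fin n) (Fin n) ℝ) (p : ℝ) : Prop where
  mono : ∀ s t, 1 ≤ s → s ≤ t → F s ≤ F t
  le : ∀ t, 1 ≤ t → F t ≤ mΩ
  adapted : ∀ t, 1 ≤ t → Measurable[F t] (y t)
  k_pos : 1 ≤ k
  posDef : Γ.PosDef
  p_mem : p ∈ Set.Icc (0 : ℝ) 1
  smallBall : ∀ v : Vec n, ‖v‖ = 1 → ∀ t, 1 ≤ t → ∀ᵐ ω ∂μ,
    p ≤ (1 / (k : ℝ)) * ∑ i ∈ Finset.Icc 1 k,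
      (μ[Set.indicator {ω' | √(WithLp.ofLp v ⬝ᵥ (Γ *ᵥ WithLp.ofLp v)) ≤ |inner ℝ v (y (t + i) ω')|}
        (fun _ => (1 : ℝ)) | F t]) ω

/-! ### Set-membership estimation -/

/-- The set-membership estimate
`Θ_T = ⋂_{t < T} {θ' : x_{t+1} - θ' φ(x_t, u_t) ∈ 𝒲}` with `𝒲 = {‖·‖_∞ ≤ wmax}`. -/
def smeSet {Ω : Type*} {nx nφ : ℕ} (wmax : ℝ) (x : ℕ → Ω → Vec nx) (y : ℕ → Ω → Vec nφ)
    (T : ℕ) (ω : Ω) : Set (Matrix (Fin nx) (Fin nφ) ℝ) :=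
  ⋂ t ∈ Finset.range T, {θ' | linfNorm (x (t + 1) ω - linResp θ' (y t ω)) ≤ wmax}

open scoped Matrix.Norms.Frobenius in
/-- The diameter of a set of matrices in the Frobenius norm, with value `∞` if unbounded. -/
noncomputable def frobDiam {n k : ℕ} (S : Set (Matrix (Fin n) (Fin k) ℝ)) : ℝ≥0∞ :=
  Metric.ediam S

/-- `a₁ = s p / 4`. -/
noncomputable def smeA1 (s p : ℝ) : ℝ := s * p / 4

/-- `a₂ = 64 b² / (s² p²)`. -/
noncomputable def smeA2 (s p b : ℝ) : ℝ := 64 * b ^ 2 / (s ^ 2 * p ^ 2)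

/-- `a₃ = p² / 8`. -/
noncomputable def smeA3 (p : ℝ) : ℝ := p ^ 2 / 8

/-- `a₄ = 16 b √n_x / (s p)`. -/
noncomputable def smeA4 (nx : ℕ) (s p b : ℝ) : ℝ := 16 * b * √(nx : ℝ) / (s * p)

/-! The small-ball condition comes from analyticity. Given the history up to `t`, the next feature
vector is `φ (z + w, π (z + w) + e)`, where `z` is determined by the past and the noise pair `(w,
e)` is fresh and independent of it. For a unit vector `v`, the function `⟪v, φ (z + w, π (z + w) +
e)⟫` is analytic in `(w, e)` and not identically zero, because the features are linearly
independent. Its zero set is therefore Lebesgue null and cannot carry the product of two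
semi-continuous laws. Stability confines `z` to a compact set almost surely, and compactness in `(z,
v)` makes the estimate uniform (`exists_uniform_smallBall`). The feature bound follows from the same
compactness.

For the diameter, a large set-membership estimate contains a matrix one of whose rows is far from
the true one. By convexity the error of that row can be shrunk to `r • u` with `‖u‖ = 1` and `r`
fixed in advance, and at every time the disturbance shifted by `r ⟪u, y_t⟫` must still lie in
`[-wmax, wmax]` (`exists_direction_of_lt_frobDiam`). Replace `u` by a point `v` of a finite net of
the sphere. Whenever `|⟪v, y_t⟫| ≥ s`, the sign of `⟪u, y_t⟫` is known and its size is at least `s /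
8`, so the disturbance, independent of the past, must avoid a neighbourhood of one endpoint. That
neighbourhood has probability at least `q`.

Two martingale-type estimates finish the argument. The expectation of `2⁻ᶜ`, with `c` the number of
excited times, shows that few excitations are unlikely (`measureReal_eventCount_lt_le`). A
supermartingale shows that surviving `N` excitations has probability at most `(1 - q) ^ N`
(`measureReal_survival_le`). A union bound over the net and the `nx` rows gives
`measureReal_lt_frobDiam_le`, with `N` still free. Both claims are instances: `N = ⌈T / m⌉` gives
the tail bound and `N = ⌈p T / 4⌉` gives the rate. Since the net lives on the sphere of a single
row, its size stays well below the factors `a₂ ^ nφ` and `a₄ ^ (nx * nφ)` allowed in the tail bound.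
-/

/-! ### Zero sets of analytic functions. -/

/-- The zero set of a real-analytic function which is not identically zero is Lebesgue null. -/
theorem AnalyticOnNhd.measure_zeroSet_eq_zero {E : Type*} [NormedAddCommGroup E] [NormedSpace ℝ E]
    [FiniteDimensional ℝ E] [MeasurableSpace E] [BorelSpace E] (μ : Measure E)
    [μ.IsAddHaarMeasure] {f : E → ℝ} (hf : AnalyticOnNhd ℝ f Set.univ) {z : E} (hz : f z ≠ 0) :
    μ {x | f x = 0} = 0 := by
  have hcont : Continuous f := continuousOn_univ.1 hf.continuousOn
  have hclosed : IsClosed {x | f (z + x) = 0} :=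
    isClosed_eq (hcont.comp (continuous_const.add continuous_id)) continuous_const
  -- Polar coordinates around the point `z`, where `f` does not vanish: on every ray from `z` the
  -- restriction of `f` is analytic and nonzero at the origin, so its zeros are isolated, hence
  -- countable, hence null for the radial measure.
  have key : μ {x | f (z + x) = 0} = 0 := by
    have hsub : {x | f (z + x) = 0} ⊆ ((↑) : ({0}ᶜ : Set E) → E) ''
        ((↑) ⁻¹' {x | f (z + x) = 0}) := by
      intro x hx
      have hx0 : x ≠ 0 := by rintro rfl; simp at hx; exact hz hx
      exact ⟨⟨x, hx0⟩, hx, rfl⟩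
    refine measure_mono_null hsub ?_
    rw [← MeasurableEmbedding.comap_apply
      (MeasurableEmbedding.subtype_coe (measurableSet_singleton (0 : E)).compl)]
    have mp := μ.measurePreserving_homeomorphUnitSphereProd
    have hS : MeasurableSet ((↑) ⁻¹' {x | f (z + x) = 0} : Set ({0}ᶜ : Set E)) :=
      measurable_subtype_coe hclosed.measurableSet
    set S := ((↑) ⁻¹' {x | f (z + x) = 0} : Set ({0}ᶜ : Set E)) with hSdef
    have h1 : S = (homeomorphUnitSphereProd E) ⁻¹' ((homeomorphUnitSphereProd E).symm ⁻¹' S) := by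
      ext y; simp
    rw [h1, mp.measure_preimage
      ((homeomorphUnitSphereProd E).symm.measurable hS).nullMeasurableSet]
    rw [Measure.measure_prod_null ((homeomorphUnitSphereProd E).symm.measurable hS)]
    refine Eventually.of_forall fun u => ?_
    refine (withDensity_absolutelyContinuous _ _ :
      Measure.volumeIoiPow (Module.finrank ℝ E - 1) ≪ _) ?_
    rw [MeasurableEmbedding.comap_apply
      (MeasurableEmbedding.subtype_coe measurableSet_Ioi)]
    have hg : AnalyticOnNhd ℝ (fun t : ℝ => f (z + t • (u : E))) Set.univ := by
      intro t _
      refine AnalyticAt.fun_comp (hf _ trivial) ?_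
      fun_prop
    have hcount : Set.Countable {t : ℝ | f (z + t • (u : E)) = 0} := by
      have := hg.preimage_zero_mem_codiscrete (x := 0) (by simpa using hz)
      obtain ⟨-, hd⟩ := mem_codiscrete'.1 this
      have hT : {t : ℝ | f (z + t • (u : E)) = 0} =
          ((fun t : ℝ => f (z + t • (u : E))) ⁻¹' {0}ᶜ)ᶜ := by ext; simp
      rw [hT]
      have := hd.to_subtype
      exact Set.countable_coe_iff.1 (TopologicalSpace.separableSpace_iff_countable.1 inferInstance)
    refine measure_mono_null ?_ (hcount.measure_zero _)
    rintro _ ⟨t, ht, rfl⟩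
    simpa [hSdef, homeomorphUnitSphereProd] using ht
  have : {x | f x = 0} = (fun x => -z + x) ⁻¹' {x | f (z + x) = 0} := by ext; simp
  rw [this, measure_preimage_add, key]

/-! ### Nets of the unit sphere. -/

/-- A `ε`-separated set of unit vectors has at most `(1 + 2 / ε) ^ n` elements. -/
theorem card_le_of_separated_sphere {n : ℕ} {ε : ℝ} (hε : 0 < ε) (s : Finset (Vec n))
    (hs : ∀ c ∈ s, ‖c‖ = 1) (h : ∀ c ∈ s, ∀ d ∈ s, c ≠ d → ε < ‖c - d‖) :
    (s.card : ℝ) ≤ (1 + 2 / ε) ^ n := by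
  have hδ : 0 < ε / 2 := by positivity
  have hρ : 0 < 1 + ε / 2 := by positivity
  set A := ⋃ c ∈ s, Metric.ball (c : Vec n) (ε / 2) with hA
  have D : Set.PairwiseDisjoint (s : Set (Vec n)) fun c => Metric.ball (c : Vec n) (ε / 2) := by
    intro c hc d hd hcd
    apply Metric.ball_disjoint_ball
    rw [dist_eq_norm]
    linarith [h c hc d hd hcd]
  have A_subset : A ⊆ Metric.ball (0 : Vec n) (1 + ε / 2) := by
    refine Set.iUnion₂_subset fun x hx => ?_
    apply Metric.ball_subset_ball'
    rw [dist_zero_right, hs x hx, add_comm]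
  -- Volume comparison: the balls of radius `ε / 2` around the points are disjoint and fit in the
  -- ball of radius `1 + ε / 2`.
  have I : (s.card : ℝ≥0∞) * ENNReal.ofReal ((ε / 2) ^ n) * volume (Metric.ball (0 : Vec n) 1) ≤
      ENNReal.ofReal ((1 + ε / 2) ^ n) * volume (Metric.ball (0 : Vec n) 1) := by
    have hfin : Module.finrank ℝ (Vec n) = n := finrank_euclideanSpace_fin
    calc
      _ = volume A := by
        rw [hA, measure_biUnion_finset D fun c _ => measurableSet_ball]
        simp only [Measure.addHaar_ball_of_pos volume _ hδ, hfin]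
        simp only [Finset.sum_const, nsmul_eq_mul, mul_assoc]
      _ ≤ volume (Metric.ball (0 : Vec n) (1 + ε / 2)) := measure_mono A_subset
      _ = _ := by simp only [Measure.addHaar_ball_of_pos volume _ hρ, hfin]
  have J := (ENNReal.mul_le_mul_iff_left
    (Metric.measure_ball_pos volume (0 : Vec n) zero_lt_one).ne' measure_ball_lt_top.ne).1 I
  have K := ENNReal.toReal_le_of_le_ofReal (by positivity) J
  rw [ENNReal.toReal_mul, ENNReal.toReal_natCast, ENNReal.toReal_ofReal (by positivity)] at K
  have : (1 + 2 / ε) ^ n = (1 + ε / 2) ^ n / (ε / 2) ^ n := by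
    rw [← div_pow]; congr 1; field_simp; ring
  rw [this, le_div_iff₀ (by positivity)]
  exact K

/-- The unit sphere of `ℝⁿ` has an `ε`-net with at most `(1 + 2 / ε) ^ n` elements. -/
theorem exists_sphere_net {n : ℕ} {ε : ℝ} (hε : 0 < ε) :
    ∃ V : Finset (Vec n), (∀ v ∈ V, ‖v‖ = 1) ∧ (∀ u : Vec n, ‖u‖ = 1 → ∃ v ∈ V, ‖u - v‖ ≤ ε) ∧
      (V.card : ℝ) ≤ (1 + 2 / ε) ^ n := by
  classical
  -- A separated set of maximal cardinality is a net: a point farther than `ε` from all its elements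
  -- could be added to it.
  let S : Set ℕ := {k | ∃ s : Finset (Vec n), s.card = k ∧ (∀ c ∈ s, ‖c‖ = 1) ∧
    ∀ c ∈ s, ∀ d ∈ s, c ≠ d → ε < ‖c - d‖}
  have hbdd : BddAbove S := by
    refine ⟨⌊(1 + 2 / ε) ^ n⌋₊, ?_⟩
    rintro _ ⟨s, rfl, h1, h2⟩
    exact Nat.le_floor (card_le_of_separated_sphere hε s h1 h2)
  obtain ⟨V, hV, h1, h2⟩ := Nat.sSup_mem (s := S) ⟨0, ∅, by simp⟩ hbdd
  refine ⟨V, h1, fun u hu => ?_, card_le_of_separated_sphere hε V h1 h2⟩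
  by_contra! hcon
  have hu' : u ∉ V := fun hmem => by
    have := hcon u hmem
    simp only [sub_self, norm_zero] at this
    linarith
  have hmem : V.card + 1 ∈ S := by
    refine ⟨insert u V, Finset.card_insert_of_notMem hu', ?_, ?_⟩
    · simpa [hu] using h1
    · intro c hc d hd hcd
      rcases Finset.mem_insert.1 hc with hc' | hc' <;> rcases Finset.mem_insert.1 hd with hd' | hd'
      · exact absurd (hc'.trans hd'.symm) hcd
      · exact hc' ▸ hcon d hd'
      · rw [hd', norm_sub_rev]; exact hcon c hc'
      · exact h2 c hc' d hd' hcd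
  have := le_csSup hbdd hmem
  omega

/-! ### Independence of fresh noise from the history. -/

section Independence

variable {Ω : Type*} {mΩ : MeasurableSpace Ω} {μ : Measure Ω}

/-- Two independent families of σ-algebras, jointly independent of each other, form an independent
family. -/
theorem iIndep_sumElim [IsZeroOrProbabilityMeasure μ] {ι κ : Type*} {m₁ : ι → MeasurableSpace Ω}
    {m₂ : κ → MeasurableSpace Ω} (h₁ : iIndep m₁ μ) (h₂ : iIndep m₂ μ)
    (h : Indep (⨆ i, m₁ i) (⨆ j, m₂ j) μ) : iIndep (Sum.elim m₁ m₂) μ := by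
  classical
  rw [iIndep_iff] at *
  intro s f hf
  have hl : ∀ i ∈ s.toLeft, MeasurableSet[m₁ i] (f (Sum.inl i)) := fun i hi =>
    hf _ (Finset.mem_toLeft.1 hi)
  have hr : ∀ i ∈ s.toRight, MeasurableSet[m₂ i] (f (Sum.inr i)) := fun i hi =>
    hf _ (Finset.mem_toRight.1 hi)
  have hs : (⋂ i ∈ s, f i) =
      (⋂ i ∈ s.toLeft, f (Sum.inl i)) ∩ ⋂ j ∈ s.toRight, f (Sum.inr j) := by
    ext ω
    simp [Sum.forall]
  rw [hs, (Indep_iff _ _ μ).1 h, h₁ _ hl, h₂ _ hr]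
  · conv_rhs => rw [← Finset.toLeft_disjSum_toRight (u := s)]
    rw [Finset.prod_disjSum]
  · exact Finset.measurableSet_biInter _ fun i hi => le_iSup m₁ i _ (hl i hi)
  · exact Finset.measurableSet_biInter _ fun i hi => le_iSup m₂ i _ (hr i hi)

end Independence

theorem history_mono {Ω : Type*} {nx nu : ℕ} (π : Vec nx → Vec nu) (w : ℕ → Ω → Vec nx)
    (η : ℕ → Ω → Vec nu) (x : ℕ → Ω → Vec nx) {s t : ℕ} (hst : s ≤ t) : history π w η x s ≤ history π w η x t := by
  refine sup_le_sup (sup_le_sup (sup_le_sup ?_ ?_) ?_) ?_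
  · exact iSup₂_le fun k hk => le_iSup₂_of_le k (hk.trans_le hst) le_rfl
  · exact iSup₂_le fun k hk => le_iSup₂_of_le k (hk.trans hst) le_rfl
  · exact iSup₂_le fun k hk => le_iSup₂_of_le k (hk.trans hst) le_rfl
  · exact iSup₂_le fun k hk => le_iSup₂_of_le k (hk.trans hst) le_rfl

theorem measurable_disturbance_history {Ω : Type*} {nx nu : ℕ} (π : Vec nx → Vec nu) (w : ℕ → Ω → Vec nx)
    (η : ℕ → Ω → Vec nu) (x : ℕ → Ω → Vec nx) {k t : ℕ} (hk : k < t) :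
    Measurable[history π w η x t] (w k) :=
  Measurable.mono (comap_measurable (w k)) (le_sup_of_le_left (le_sup_of_le_left
    (le_sup_of_le_left (le_iSup₂_of_le k hk le_rfl)))) le_rfl

section ClosedLoop

variable {Ω : Type*} [mΩ : MeasurableSpace Ω] {μ : Measure Ω}
  {nx nu nφ : ℕ} {θ : Matrix (Fin nx) (Fin nφ) ℝ} {φ : Vec nx × Vec nu → Vec nφ}
  {π : Vec nx → Vec nu} {w : ℕ → Ω → Vec nx} {η : ℕ → Ω → Vec nu} {x : ℕ → Ω → Vec nx}
  {wmax umax ρx ρ : ℝ} {qw : ℝ → ℝ}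

/-- The σ-algebras generated by the individual noise variables. -/
@[reducible] def noiseAlgebra (w : ℕ → Ω → Vec nx) (η : ℕ → Ω → Vec nu) : ℕ ⊕ ℕ → MeasurableSpace Ω :=
  Sum.elim (fun t => MeasurableSpace.comap (w t) inferInstance)
    (fun t => MeasurableSpace.comap (η t) inferInstance)

/-- The indices of the noise variables which enter the history up to time `t`. -/
def pastNoise (t : ℕ) : Set (ℕ ⊕ ℕ) := {i | Sum.elim (· < t) (· ≤ t) i}

theorem continuous_linResp {n k : ℕ} (θ : Matrix (Fin n) (Fin k) ℝ) :
    Continuous (linResp θ) := by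
  unfold linResp
  exact (PiLp.continuous_toLp 2 _).comp
    (Continuous.matrix_mulVec continuous_const (PiLp.continuous_ofLp 2 _))

namespace IsClosedLoopSystem

theorem continuous_features
    (h : IsClosedLoopSystem μ θ φ π w η x wmax umax ρx ρ qw) : Continuous φ := by
  have : φ = fun z => WithLp.toLp 2 fun i => φ z i := by ext; simp
  rw [this]
  exact (PiLp.continuous_toLp 2 _).comp
    (continuous_pi fun i => continuousOn_univ.1 (h.features_analytic i).continuousOn)

theorem continuous_policy
    (h : IsClosedLoopSystem μ θ φ π w η x wmax umax ρx ρ qw) : Continuous π :=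
  continuousOn_univ.1 h.policy_analytic.continuousOn

theorem iIndep_noiseAlgebra [IsProbabilityMeasure μ]
    (h : IsClosedLoopSystem μ θ φ π w η x wmax umax ρx ρ qw) :
    iIndep (noiseAlgebra w η) μ := by
  refine iIndep_sumElim h.disturbance.indep h.inputNoise.indep ?_
  have := h.indep
  rw [IndepFun_iff_Indep] at this
  convert this using 1 <;>
  simp only [MeasurableSpace.pi, MeasurableSpace.comap_iSup, MeasurableSpace.comap_comp] <;> rfl

theorem noiseAlgebra_le
    (h : IsClosedLoopSystem μ θ φ π w η x wmax umax ρx ρ qw) (i : ℕ ⊕ ℕ) : noiseAlgebra w η i ≤ mΩ := by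
  rcases i with t | t
  · exact (h.disturbance.measurable t).comap_le
  · exact (h.inputNoise.measurable t).comap_le

/-- The state `x_t` is a function of the noise variables before time `t`. -/
theorem measurable_state_noise
    (h : IsClosedLoopSystem μ θ φ π w η x wmax umax ρx ρ qw) (t : ℕ) :
    ∀ s, t ≤ s → Measurable[⨆ i ∈ pastNoise s, noiseAlgebra w η i] (x t) := by
  induction t with
  | zero =>
    intro s _
    rw [funext h.init]
    exact measurable_const
  | succ t ih =>
    intro s hs
    rw [funext (h.step t)]
    have hx := ih s (by omega)
    have hw : Measurable[⨆ i ∈ pastNoise s, noiseAlgebra w η i] (w t) :=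
      Measurable.mono (comap_measurable (w t))
        (le_iSup₂_of_le (f := fun i (_ : i ∈ pastNoise s) => noiseAlgebra w η i) (Sum.inl t)
          (show t < s by omega) le_rfl) le_rfl
    have hη : Measurable[⨆ i ∈ pastNoise s, noiseAlgebra w η i] (η t) :=
      Measurable.mono (comap_measurable (η t))
        (le_iSup₂_of_le (f := fun i (_ : i ∈ pastNoise s) => noiseAlgebra w η i) (Sum.inr t)
          (show t ≤ s by omega) le_rfl) le_rfl
    exact ((continuous_linResp θ).measurable.comp (h.continuous_features.measurable.comp
      (hx.prodMk ((h.continuous_policy.measurable.comp hx).add hη)))).add hw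

/-- States and policy values are functions of past noise, so the history lives in a σ-algebra
indexed by noise variables. Independence from fresh noise then reduces to disjointness of index
sets. -/
theorem history_le_noise
    (h : IsClosedLoopSystem μ θ φ π w η x wmax umax ρx ρ qw) (t : ℕ) :
    history π w η x t ≤ ⨆ i ∈ pastNoise t, noiseAlgebra w η i := by
  refine sup_le (sup_le (sup_le ?_ ?_) ?_) ?_
  · exact iSup₂_le fun k hk => le_iSup₂_of_le
      (f := fun i (_ : i ∈ pastNoise t) => noiseAlgebra w η i) (Sum.inl k) hk le_rfl
  · exact iSup₂_le fun k hk => (h.measurable_state_noise k t hk).comap_le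
  · exact iSup₂_le fun k hk =>
      (h.continuous_policy.measurable.comp (h.measurable_state_noise k t hk)).comap_le
  · exact iSup₂_le fun k hk => le_iSup₂_of_le
      (f := fun i (_ : i ∈ pastNoise t) => noiseAlgebra w η i) (Sum.inr k) hk le_rfl

/-- The noise variables which do not enter the history are independent of it. -/
theorem indep_history [IsProbabilityMeasure μ]
    (h : IsClosedLoopSystem μ θ φ π w η x wmax umax ρx ρ qw) {S : Set (ℕ ⊕ ℕ)} {t : ℕ}
    (hS : Disjoint (pastNoise t) S) :
    Indep (history π w η x t) (⨆ i ∈ S, noiseAlgebra w η i) μ :=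
  indep_of_indep_of_le_left (indep_iSup_of_disjoint h.noiseAlgebra_le h.iIndep_noiseAlgebra hS)
    (h.history_le_noise t)

theorem history_le
    (h : IsClosedLoopSystem μ θ φ π w η x wmax umax ρx ρ qw) (t : ℕ) : history π w η x t ≤ mΩ :=
  (h.history_le_noise t).trans (iSup₂_le fun i _ => h.noiseAlgebra_le i)

/-- The disturbance `w_t` is independent of the history up to time `t`. -/
theorem indep_disturbance_history [IsProbabilityMeasure μ]
    (h : IsClosedLoopSystem μ θ φ π w η x wmax umax ρx ρ qw) (t : ℕ) :
    Indep (history π w η x t) (MeasurableSpace.comap (w t) inferInstance) μ := by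
  have := h.indep_history (S := {Sum.inl t}) (t := t) (by
    rw [Set.disjoint_singleton_right]
    exact fun hmem => lt_irrefl t hmem)
  simpa using this

/-- The pair `(w_t, η_{t+1})` is independent of the history up to time `t`. -/
theorem indep_noise_history [IsProbabilityMeasure μ]
    (h : IsClosedLoopSystem μ θ φ π w η x wmax umax ρx ρ qw) (t : ℕ) :
    Indep (history π w η x t)
      (MeasurableSpace.comap (fun ω => (w t ω, η (t + 1) ω)) inferInstance) μ := by
  have := h.indep_history (S := {Sum.inl t, Sum.inr (t + 1)}) (t := t) (by
    rw [Set.disjoint_right]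
    rintro i (rfl | rfl) hmem
    · exact lt_irrefl t hmem
    · exact Nat.not_succ_le_self t hmem)
  have hcomap : MeasurableSpace.comap (fun ω => (w t ω, η (t + 1) ω)) inferInstance =
      MeasurableSpace.comap (w t) inferInstance ⊔
        MeasurableSpace.comap (η (t + 1)) inferInstance := MeasurableSpace.comap_prodMk _ _
  rw [hcomap]
  simpa [iSup_or, iSup_sup_eq] using this

theorem indepFun_disturbance_inputNoise [IsProbabilityMeasure μ]
    (h : IsClosedLoopSystem μ θ φ π w η x wmax umax ρx ρ qw) (t s : ℕ) :
    IndepFun (w t) (η s) μ :=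
  h.indep.comp (φ := fun f : ℕ → Vec nx => f t) (ψ := fun f : ℕ → Vec nu => f s)
    (measurable_pi_apply t) (measurable_pi_apply s)

end IsClosedLoopSystem

theorem IsClosedLoopSystem.measurable_features_history
    (h : IsClosedLoopSystem μ θ φ π w η x wmax umax ρx ρ qw) {k t : ℕ} (hk : k ≤ t) :
    Measurable[history π w η x t] (features φ π η x k) := by
  have hx : Measurable[history π w η x t] (x k) :=
    Measurable.mono (comap_measurable (x k)) (le_sup_of_le_left (le_sup_of_le_left
      (le_sup_of_le_right (le_iSup₂_of_le k hk le_rfl)))) le_rfl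
  have hη : Measurable[history π w η x t] (η k) :=
    Measurable.mono (comap_measurable (η k))
      (le_sup_of_le_right (le_iSup₂_of_le k hk le_rfl)) le_rfl
  exact h.continuous_features.measurable.comp
    (hx.prodMk ((h.continuous_policy.measurable.comp hx).add hη))

end ClosedLoop

/-! ### Small-ball estimates, uniform in parameters and conditional on the past. -/

/-- The product of two semi-continuous laws is not carried by a Lebesgue null set. -/
theorem IsSemicontinuousLaw.prod_ne_one {n m : ℕ} {ν₁ : Measure (Vec n)} {ν₂ : Measure (Vec m)}
    [IsProbabilityMeasure ν₁] [IsProbabilityMeasure ν₂] (h₁ : IsSemicontinuousLaw ν₁)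
    (h₂ : IsSemicontinuousLaw ν₂) {Z : Set (Vec n × Vec m)} (hZ : MeasurableSet Z)
    (hvol : (volume : Measure (Vec n × Vec m)) Z = 0) : (ν₁.prod ν₂) Z ≠ 1 := by
  intro hone
  have hae : ∀ᵐ a ∂ν₁, ∀ᵐ b ∂ν₂, (a, b) ∈ Z :=
    Measure.ae_ae_of_ae_prod ((prob_compl_eq_zero_iff hZ).2 hone)
  rw [Measure.volume_eq_prod, Measure.measure_prod_null hZ] at hvol
  -- Almost every section has full `ν₂`-probability, so it is not Lebesgue null. But by Fubini only
  -- a null set of points `a` has a non-null section, so `ν₁` would be carried by a null set.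
  refine h₁ ⟨{a | volume (Prod.mk a ⁻¹' Z) ≠ 0}, ?_, ?_⟩
  · simpa [Filter.EventuallyEq, ae_iff] using hvol
  · rw [← measure_univ (μ := ν₁)]
    refine measure_congr ?_
    filter_upwards [hae] with a ha
    refine eq_true (?_ : volume (Prod.mk a ⁻¹' Z) ≠ 0)
    intro h0
    exact h₂ ⟨_, h0, by
      rw [← measure_univ (μ := ν₂)]
      refine measure_congr ?_
      filter_upwards [ha] with b hb
      exact eq_true hb⟩

/-- A family of random variables `g λ`, continuous in the parameter `λ` and none of them almost
surely zero, satisfies a small-ball estimate uniformly over compact sets of parameters. -/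
theorem exists_uniform_smallBall {Λ E : Type*} [TopologicalSpace Λ] [FirstCountableTopology Λ]
    [TopologicalSpace E] [MeasurableSpace E] [BorelSpace E]
    (ν : Measure E) [IsProbabilityMeasure ν] {g : Λ → E → ℝ}
    (hg : Continuous fun z : Λ × E => g z.1 z.2) {K : Set Λ} (hK : IsCompact K)
    (hne : ∀ a ∈ K, ν {e | g a e = 0} ≠ 1) :
    ∃ c : ℝ, 0 < c ∧ c < 1 ∧ ∀ a ∈ K, c ≤ ν.real {e | c ≤ |g a e|} := by
  rcases K.eq_empty_or_nonempty with rfl | hKne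
  · exact ⟨1 / 2, by norm_num, by norm_num, by simp⟩
  have hga : ∀ a, Continuous (g a) := fun a => hg.comp (Continuous.prodMk_right a)
  have hint : ∀ a, Integrable (fun e => min |g a e| 1) ν := fun a =>
    Integrable.of_bound ((hga a).abs.min continuous_const).measurable.aestronglyMeasurable 1
      (Eventually.of_forall fun e => by
        rw [Real.norm_of_nonneg (by positivity)]; exact min_le_right _ _)
  -- Truncation at `1` makes dominated convergence available, so `F` is continuous and attains its
  -- minimum on `K`. The minimum is positive because no `g a` with `a ∈ K` vanishes almost surely.
  set F : Λ → ℝ := fun a => ∫ e, min |g a e| 1 ∂ν with hF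
  have hFc : Continuous F := by
    refine continuous_of_dominated (bound := fun _ => 1) (fun a => (hint a).aestronglyMeasurable)
      (fun a => Eventually.of_forall fun e => ?_) (integrable_const _)
      (Eventually.of_forall fun e => ?_)
    · rw [Real.norm_of_nonneg (by positivity)]; exact min_le_right _ _
    · exact (hg.comp (Continuous.prodMk_left e)).abs.min continuous_const
  obtain ⟨a₀, ha₀, hmin⟩ := hK.exists_isMinOn hKne hFc.continuousOn
  have hle1 : F a₀ ≤ 1 := by
    calc F a₀ ≤ ∫ _, (1 : ℝ) ∂ν := integral_mono (hint a₀) (integrable_const _)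
          fun e => min_le_right _ _
      _ = 1 := by simp
  have hpos : 0 < F a₀ := by
    refine lt_of_le_of_ne (integral_nonneg fun e => by positivity) fun h0 => hne a₀ ha₀ ?_
    have h0' := (integral_eq_zero_iff_of_nonneg (fun e => by positivity) (hint a₀)).1 h0.symm
    rw [← measure_univ (μ := ν)]
    refine measure_congr ?_
    filter_upwards [h0'] with e he
    refine eq_true (?_ : g a₀ e = 0)
    simp only [Pi.zero_apply] at he
    rcases min_choice |g a₀ e| 1 with hm | hm
    · rw [hm] at he; exact abs_eq_zero.1 he
    · rw [hm] at he; norm_num at he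
  -- With `c = F a₀ / 2`, the truncated integrand is at most `c` plus the indicator of `c ≤ |g a|`,
  -- so that event has probability at least `F a₀ - c = c`.
  refine ⟨F a₀ / 2, by positivity, by linarith, fun a ha => ?_⟩
  have hms : MeasurableSet {e | F a₀ / 2 ≤ |g a e|} :=
    (isClosed_le continuous_const (hga a).abs).measurableSet
  have h1 : F a ≤ ∫ e, (F a₀ / 2 + Set.indicator {e | F a₀ / 2 ≤ |g a e|} (fun _ => (1 : ℝ)) e) ∂ν := by
    refine integral_mono (hint a) ((integrable_const _).add
      ((integrable_const _).indicator hms)) fun e => ?_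
    by_cases he : F a₀ / 2 ≤ |g a e|
    · simp only [Set.indicator, Set.mem_ofPred_eq, he, if_true]
      exact (min_le_right _ _).trans (by linarith)
    · simp only [Set.indicator, Set.mem_ofPred_eq, he, if_false]
      exact (min_le_left _ _).trans (by linarith)
  rw [integral_add (integrable_const _) ((integrable_const _).indicator hms),
    integral_indicator_const _ hms] at h1
  have h2 := isMinOn_iff.1 hmin a ha
  simp only [integral_const, probReal_univ, smul_eq_mul, one_mul, mul_one] at h1
  linarith

section Conditional

variable {Ω : Type*} {m mΩ : MeasurableSpace Ω} {μ : Measure Ω} [IsProbabilityMeasure μ]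

/-- A lower bound for the integrals over the sets of a sub-σ-algebra gives one for the conditional
expectation. -/
theorem le_condExp_of_forall_setIntegral (hm : m ≤ mΩ) {f : Ω → ℝ}
    (hf : Integrable f μ) {p : ℝ}
    (h : ∀ A, MeasurableSet[m] A → p * μ.real A ≤ ∫ ω in A, f ω ∂μ) : ∀ᵐ ω ∂μ, p ≤ (μ[f|m]) ω := by
  set A := {ω | (μ[f|m]) ω < p} with hA
  have hAm : MeasurableSet[m] A :=
    StronglyMeasurable.measurableSet_lt stronglyMeasurable_condExp stronglyMeasurable_const
  have hA' := hm _ hAm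
  rw [ae_iff]
  simp only [not_le]
  by_contra hne
  have h1 := h A hAm
  rw [← setIntegral_condExp hm hf hAm] at h1
  have hi : IntegrableOn (fun ω => p - (μ[f|m]) ω) A μ :=
    ((integrable_const p).sub integrable_condExp).integrableOn
  have h2 : 0 < ∫ ω in A, (p - (μ[f|m]) ω) ∂μ := by
    rw [setIntegral_pos_iff_support_of_nonneg_ae]
    · refine (pos_iff_ne_zero.2 hne).trans_le (measure_mono fun ω hω => ⟨?_, hω⟩)
      simp only [Function.mem_support]
      have : (μ[f|m]) ω < p := hω
      linarith
    · filter_upwards [ae_restrict_mem hA'] with ω hω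
      have : (μ[f|m]) ω < p := hω
      simp only [Pi.zero_apply]; linarith
    · exact hi
  rw [integral_sub (integrable_const p).integrableOn integrable_condExp.integrableOn] at h2
  simp only [integral_const, measureReal_restrict_apply_univ, smul_eq_mul] at h2
  linarith

/-- If `X` is `m`-measurable and `ξ` is independent of `m`, the conditional probability of
`(X, ξ) ∈ B` is bounded below by the probability of `(a, ξ) ∈ B`, minimised over the values `a`. -/
theorem le_condExp_indicator_of_indep {Λ E : Type*} [MeasurableSpace Λ] [MeasurableSpace E]
    (hm : m ≤ mΩ) {X : Ω → Λ} {ξ : Ω → E} (hX : Measurable[m] X)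
    (hξ : Measurable ξ) (hind : Indep m (MeasurableSpace.comap ξ inferInstance) μ)
    {B : Set (Λ × E)} (hB : MeasurableSet B) {p : ℝ}
    (h : ∀ᵐ ω ∂μ, p ≤ (μ.map ξ).real {e | (X ω, e) ∈ B}) :
    ∀ᵐ ω ∂μ, p ≤ (μ[Set.indicator {ω | (X ω, ξ ω) ∈ B} (fun _ => (1 : ℝ))|m]) ω := by
  classical
  have hXm : Measurable X := hX.mono hm le_rfl
  have hBm : MeasurableSet {ω | (X ω, ξ ω) ∈ B} := (hXm.prodMk hξ) hB
  refine le_condExp_of_forall_setIntegral hm ((integrable_const _).indicator hBm) fun A hA => ?_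
  rw [setIntegral_indicator hBm, setIntegral_const, smul_eq_mul, mul_one]
  -- Recording the indicator of `A` together with `X` turns the integral over `A` into a probability
  -- for the independent pair `(Y, ξ)`, to which Fubini applies.
  set Y : Ω → Λ × ℝ := fun ω => (X ω, A.indicator 1 ω) with hY
  have hYm : Measurable[m] Y := Measurable.prodMk hX
    (Measurable.indicator (m := m) (@measurable_const _ _ _ m 1) hA)
  have hYξ : IndepFun Y ξ μ := by
    rw [IndepFun_iff_Indep]
    exact indep_of_indep_of_le_left hind hYm.comap_le
  have hmap := (indepFun_iff_map_prod_eq_prod_map_map (hYm.mono hm le_rfl).aemeasurable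
    hξ.aemeasurable).1 hYξ
  set C : Set ((Λ × ℝ) × E) := {c | c.1.2 = 1 ∧ (c.1.1, c.2) ∈ B} with hC
  have hCm : MeasurableSet C :=
    ((measurable_snd.comp measurable_fst) (measurableSet_singleton 1)).inter
      (((measurable_fst.comp measurable_fst).prodMk measurable_snd) hB)
  have := Measure.isProbabilityMeasure_map (μ := μ) hξ.aemeasurable
  have h1 : μ (A ∩ {ω | (X ω, ξ ω) ∈ B}) = ∫⁻ ω, (μ.map ξ) (Prod.mk (Y ω) ⁻¹' C) ∂μ := by
    rw [← lintegral_map (measurable_measure_prodMk_left hCm) (hYm.mono hm le_rfl),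
      ← Measure.prod_apply hCm, ← hmap,
      Measure.map_apply ((hYm.mono hm le_rfl).prodMk hξ) hCm]
    congr 1
    ext ω
    by_cases hω : ω ∈ A <;> simp [hC, hY, hω]
  have h2 : ENNReal.ofReal p * μ A ≤ μ (A ∩ {ω | (X ω, ξ ω) ∈ B}) := by
    rw [h1, ← setLIntegral_const, ← lintegral_indicator (hm _ hA)]
    refine lintegral_mono_ae ?_
    filter_upwards [h] with ω hω
    by_cases hωA : ω ∈ A
    · have : Prod.mk (Y ω) ⁻¹' C = {e | (X ω, e) ∈ B} := by ext e; simp [hC, hY, hωA]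
      rw [this, Set.indicator_of_mem hωA]
      exact ENNReal.ofReal_le_of_le_toReal hω
    · simp [hωA]
  have h3 := ENNReal.toReal_mono (measure_ne_top _ _) h2
  rw [ENNReal.toReal_mul] at h3
  refine le_trans ?_ h3
  exact mul_le_mul_of_nonneg_right (ENNReal.toReal_ofReal' ▸ le_max_left _ _) measureReal_nonneg

end Conditional

/-! ### Bounded features and the small-ball condition for the closed loop. -/

section ClosedLoop

variable {Ω : Type*} [mΩ : MeasurableSpace Ω] {μ : Measure Ω}
  {nx nu nφ : ℕ} {θ : Matrix (Fin nx) (Fin nφ) ℝ} {φ : Vec nx × Vec nu → Vec nφ}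
  {π : Vec nx → Vec nu} {w : ℕ → Ω → Vec nx} {η : ℕ → Ω → Vec nu} {x : ℕ → Ω → Vec nx}
  {wmax umax ρx ρ : ℝ} {qw : ℝ → ℝ}

namespace IsClosedLoopSystem

/-- Local input-to-state stability keeps the closed-loop state bounded. -/
theorem exists_state_bound
    (h : IsClosedLoopSystem μ θ φ π w η x wmax umax ρx ρ qw) :
    ∃ R : ℝ, ∀ᵐ ω ∂μ, ∀ t, ‖x t ω‖ ≤ R := by
  obtain ⟨γ, β, hγ, hβ, hst⟩ := h.liss.stable
  refine ⟨γ (Real.toNNReal ρ), ?_⟩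
  filter_upwards [ae_all_iff.2 h.disturbance.bounded, ae_all_iff.2 h.inputNoise.bounded]
    with ω hw hη t
  set d : ℕ → Fin nx ⊕ Fin nu → ℝ := fun t => Sum.elim (w t ω).ofLp (η t ω).ofLp with hd
  have hdρ : ∀ t, ‖d t‖ ≤ ρ := fun t => by
    rw [pi_norm_le_iff_of_nonneg h.liss.ρ_pos.le]
    rintro (i | i)
    · exact (norm_le_pi_norm (w t ω).ofLp i).trans
        ((hw t).trans ((le_max_left _ _).trans h.bound_le))
    · exact (norm_le_pi_norm (η t ω).ofLp i).trans
        ((hη t).trans ((le_max_right _ _).trans h.bound_le))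
  have hstep : ∀ t, x (t + 1) ω = closedLoopMap θ φ π (x t ω) (d t) := fun t => by
    rw [h.step t ω]; rfl
  have hx0 : x 0 ω = 0 := h.init ω
  have h1 := hst (fun t => x t ω) d hstep (by simp [hx0, h.liss.ρx_pos.le]) hdρ t
  -- The system starts at the origin, so the transient term vanishes and only the gain evaluated at
  -- `ρ` remains.
  have h2 : β ‖x 0 ω‖₊ (t : ℝ≥0) = 0 := by
    rw [hx0, nnnorm_zero]; exact (hβ.classK _).zero
  simp only [h2, zero_add] at h1
  have h3 : γ (⨆ k, ‖d k‖₊) ≤ γ (Real.toNNReal ρ) := by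
    refine hγ.strictMono.monotone (ciSup_le' fun k => ?_)
    rw [← NNReal.coe_le_coe, Real.coe_toNNReal _ h.liss.ρ_pos.le]
    exact hdρ k
  exact_mod_cast h1.trans h3

theorem exists_features_bound
    (h : IsClosedLoopSystem μ θ φ π w η x wmax umax ρx ρ qw) :
    ∃ b : ℝ, ∀ t, ∀ᵐ ω ∂μ, ‖features φ π η x t ω‖ ≤ b := by
  obtain ⟨R, hR⟩ := h.exists_state_bound
  have hc : Continuous fun z : Vec nx × (Fin nu → ℝ) =>
      φ (z.1, π z.1 + WithLp.toLp 2 z.2) :=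
    h.continuous_features.comp (continuous_fst.prodMk
      ((h.continuous_policy.comp continuous_fst).add
        ((PiLp.continuous_toLp 2 _).comp continuous_snd)))
  obtain ⟨b, hb⟩ := (((isCompact_closedBall (0 : Vec nx) R).prod
    (isCompact_closedBall (0 : Fin nu → ℝ) umax)).image hc).isBounded.exists_norm_le
  refine ⟨b, fun t => ?_⟩
  filter_upwards [hR, h.inputNoise.bounded t] with ω hx hη
  refine hb _ ⟨(x t ω, (η t ω).ofLp), ⟨?_, ?_⟩, ?_⟩
  · simpa using hx t
  · simpa [linfNorm] using hη
  · simp [features]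

/-- The parameter `(z, v)` is the noiseless next state `θ y_t` together with the direction. It
ranges over a ball times a sphere almost surely, because the features are bounded; the fresh pair
`(w_t, η_{t+1})` has the same law for all `t`. So one constant works for all directions and times.
-/
theorem exists_smallBall [IsProbabilityMeasure μ]
    (h : IsClosedLoopSystem μ θ φ π w η x wmax umax ρx ρ qw) :
    ∃ s p : ℝ, 0 < s ∧ 0 < p ∧ p < 1 ∧ ∀ v : Vec nφ, ‖v‖ = 1 → ∀ t, ∀ᵐ ω ∂μ,
      p ≤ (μ[Set.indicator {ω | s ≤ |inner ℝ v (features φ π η x (t + 1) ω)|}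
        (fun _ => (1 : ℝ))|history π w η x t]) ω := by
  have hwm := h.disturbance.measurable
  have hηm := h.inputNoise.measurable
  obtain ⟨b, hb⟩ := h.exists_features_bound
  have := Measure.isProbabilityMeasure_map (μ := μ) (hwm 0).aemeasurable
  have := Measure.isProbabilityMeasure_map (μ := μ) (hηm 0).aemeasurable
  set ν : Measure (Vec nx × Vec nu) := (μ.map (w 0)).prod (μ.map (η 0)) with hν
  have hlaw : ∀ t, μ.map (fun ω => (w t ω, η (t + 1) ω)) = ν := fun t => by
    rw [(indepFun_iff_map_prod_eq_prod_map_map (hwm t).aemeasurable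
      (hηm (t + 1)).aemeasurable).1 (h.indepFun_disturbance_inputNoise t (t + 1)),
      (h.disturbance.identDistrib t).map_eq, (h.inputNoise.identDistrib (t + 1)).map_eq]
  let g : Vec nx × Vec nφ → Vec nx × Vec nu → ℝ := fun a e =>
    inner ℝ a.2 (φ (a.1 + e.1, π (a.1 + e.1) + e.2))
  have hφc := h.continuous_features
  have hπc := h.continuous_policy
  have hg : Continuous fun z : (Vec nx × Vec nφ) × (Vec nx × Vec nu) => g z.1 z.2 := by
    fun_prop
  obtain ⟨R, hR⟩ := ((isCompact_closedBall (0 : Vec nφ) b).image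
    (continuous_linResp θ)).isBounded.exists_norm_le
  have hK : IsCompact (Metric.closedBall (0 : Vec nx) R ×ˢ Metric.sphere (0 : Vec nφ) 1) :=
    (isCompact_closedBall _ _).prod (isCompact_sphere _ _)
  have hne : ∀ a ∈ Metric.closedBall (0 : Vec nx) R ×ˢ Metric.sphere (0 : Vec nφ) 1,
      ν {e | g a e = 0} ≠ 1 := by
    rintro ⟨z, v⟩ ⟨-, hv⟩
    have hv0 : v ≠ 0 := by
      rintro rfl
      simp at hv
    have hgc : Continuous (g (z, v)) := hg.comp (Continuous.prodMk_right _)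
    refine IsSemicontinuousLaw.prod_ne_one (h.disturbance.semicontinuous 0)
      (h.inputNoise.semicontinuous 0) (isClosed_eq hgc continuous_const).measurableSet ?_
    have hex : ∃ y, inner ℝ v (φ y) ≠ 0 := by
      by_contra! hzero
      refine hv0 ?_
      have hli := Fintype.linearIndependent_iff.1 h.features_linearIndependent (fun i => v i) (by
        ext y
        have := hzero y
        rw [EuclideanSpace.inner_eq_star_dotProduct] at this
        simpa [dotProduct, mul_comm] using this)
      ext i
      exact hli i
    obtain ⟨y, hy⟩ := hex
    rw [Measure.volume_eq_prod]
    -- This noise value steers state and input exactly to `y`, where the feature combination is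
    -- nonzero.
    refine AnalyticOnNhd.measure_zeroSet_eq_zero _ (z := (y.1 - z, y.2 - π y.1)) ?_
      (by simpa [g] using hy)
    intro e _
    have hsum : ∀ e, g (z, v) e = ∑ i, φ (z + e.1, π (z + e.1) + e.2) i * v i := fun e => by
      simp only [g, PiLp.inner_apply, RCLike.inner_apply, conj_trivial]
    have hA : AnalyticAt ℝ (fun e : Vec nx × Vec nu => (z + e.1, π (z + e.1) + e.2)) e := by
      have h1 : AnalyticAt ℝ (fun e : Vec nx × Vec nu => z + e.1) e :=
        analyticAt_const.add analyticAt_fst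
      exact h1.prod (((h.policy_analytic _ trivial).fun_comp h1).add analyticAt_snd)
    rw [funext hsum]
    exact Finset.analyticAt_fun_sum _ fun i _ =>
      ((h.features_analytic i _ trivial).fun_comp hA).mul analyticAt_const
  obtain ⟨c, hc0, hc1, hc⟩ := exists_uniform_smallBall ν hg hK hne
  refine ⟨c, c, hc0, hc0, hc1, fun v hv t => ?_⟩
  have hset : {ω | c ≤ |inner ℝ v (features φ π η x (t + 1) ω)|} =
      {ω | (((linResp θ (features φ π η x t ω), v) : Vec nx × Vec nφ), (w t ω, η (t + 1) ω)) ∈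
        {z : (Vec nx × Vec nφ) × (Vec nx × Vec nu) | c ≤ |g z.1 z.2|}} := by
    ext ω
    simp only [Set.mem_ofPred_eq, g, features, h.step t ω]
  rw [hset]
  refine le_condExp_indicator_of_indep (h.history_le t)
    (X := fun ω => (linResp θ (features φ π η x t ω), v)) (ξ := fun ω => (w t ω, η (t + 1) ω))
    ?_ ((hwm t).prodMk (hηm (t + 1))) (h.indep_noise_history t)
    (isClosed_le continuous_const hg.abs).measurableSet ?_
  · exact Measurable.prodMk ((continuous_linResp θ).measurable.comp
      (h.measurable_features_history le_rfl)) (@measurable_const _ _ _ (history π w η x t) v)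
  · rw [hlaw t]
    filter_upwards [hb t] with ω hω
    refine hc (linResp θ (features φ π η x t ω), v) ⟨?_, by simpa using hv⟩
    rw [mem_closedBall_zero_iff]
    exact hR _ ⟨_, by simpa using hω, rfl⟩

end IsClosedLoopSystem

/-- The threshold in the small-ball condition with `Γ = s² I`, along a unit vector. -/
theorem sqrt_dotProduct_smul_one_mulVec {n : ℕ} {s : ℝ} (hs : 0 < s) {v : Vec n} (hv : ‖v‖ = 1) :
    √(WithLp.ofLp v ⬝ᵥ (((s ^ 2) • (1 : Matrix (Fin n) (Fin n) ℝ)) *ᵥ WithLp.ofLp v)) = s := by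
  have h1 : WithLp.ofLp v ⬝ᵥ WithLp.ofLp v = 1 := by
    have := EuclideanSpace.real_norm_sq_eq v
    rw [hv] at this
    simp only [dotProduct, ← sq]
    linarith
  rw [Matrix.smul_mulVec, Matrix.one_mulVec, dotProduct_smul, h1, smul_eq_mul, mul_one,
    Real.sqrt_sq hs.le]

theorem IsClosedLoopSystem.exists_isBMSB [IsProbabilityMeasure μ]
    (h : IsClosedLoopSystem μ θ φ π w η x wmax umax ρx ρ qw) :
    ∃ s p : ℝ, 0 < s ∧ 0 < p ∧ p < 1 ∧
        IsBMSB μ (history π w η x) (features φ π η x) 1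
          ((s ^ 2) • (1 : Matrix (Fin nφ) (Fin nφ) ℝ)) p := by
  obtain ⟨s, p, hs, hp, hp1, hsp⟩ := h.exists_smallBall
  refine ⟨s, p, hs, hp, hp1, ⟨fun _ _ _ hst => history_mono π w η x hst, fun t _ => h.history_le t,
    fun t _ => h.measurable_features_history le_rfl, le_rfl, ?_, ⟨hp.le, hp1.le⟩, ?_⟩⟩
  · exact Matrix.PosDef.one.smul (by positivity)
  · intro v hv t _
    simp only [sqrt_dotProduct_smul_one_mulVec hs hv]
    simpa using hsp v hv t

end ClosedLoop

/-! ### Counting excited times and surviving them. -/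

section Counting

/-- The number of the events `A 0, …, A (n - 1)` which occur. -/
noncomputable def eventCount {Ω : Type*} (A : ℕ → Set Ω) (n : ℕ) (ω : Ω) : ℕ :=
  ∑ i ∈ Finset.range n, (A i).indicator (fun _ => 1) ω

theorem eventCount_succ_of_mem {Ω : Type*} {A : ℕ → Set Ω} {n : ℕ} {ω : Ω} (h : ω ∈ A n) :
    eventCount A (n + 1) ω = eventCount A n ω + 1 := by
  simp [eventCount, Finset.sum_range_succ, h]

theorem eventCount_succ_of_notMem {Ω : Type*} {A : ℕ → Set Ω} {n : ℕ} {ω : Ω} (h : ω ∉ A n) :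
    eventCount A (n + 1) ω = eventCount A n ω := by
  simp [eventCount, Finset.sum_range_succ, h]

theorem measurable_eventCount {Ω : Type*} {m : MeasurableSpace Ω} {A : ℕ → Set Ω} {n : ℕ}
    (h : ∀ i < n, MeasurableSet (A i)) : Measurable (eventCount A n) :=
  Finset.measurable_fun_sum _ fun i hi => measurable_const.indicator (h i (Finset.mem_range.1 hi))

theorem integral_add_three {Ω : Type*} {mΩ : MeasurableSpace Ω} {μ : Measure Ω} {f g k : Ω → ℝ} (hf : Integrable f μ) (hg : Integrable g μ)
    (hk : Integrable k μ) :
    ∫ ω, (f ω + g ω + k ω) ∂μ = (∫ ω, f ω ∂μ) + (∫ ω, g ω ∂μ) + ∫ ω, k ω ∂μ :=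
  (integral_add (hf.add hg) hk).trans (congrArg (· + _) (integral_add hf hg))

variable {Ω : Type*} {m mΩ : MeasurableSpace Ω} {μ : Measure Ω} [IsProbabilityMeasure μ]

theorem integrable_of_mem_Icc {f : Ω → ℝ} (hf : Measurable f) (h0 : ∀ ω, 0 ≤ f ω)
    (h1 : ∀ ω, f ω ≤ 1) : Integrable f μ :=
  Integrable.of_bound hf.aestronglyMeasurable 1 (Eventually.of_forall fun ω => by
    rw [Real.norm_of_nonneg (h0 ω)]; exact h1 ω)

/-- If the conditional probability of `A` given `m` is at least `p`, then `A` carries at least the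
fraction `p` of the integral of any `m`-measurable weight. -/
theorem mul_integral_le_integral_mul_indicator (hm : m ≤ mΩ) {f : Ω → ℝ} (hf : Measurable[m] f)
    (h0 : ∀ ω, 0 ≤ f ω) (h1 : ∀ ω, f ω ≤ 1) {A : Set Ω} (hA : MeasurableSet[mΩ] A) {p : ℝ}
    (h : ∀ᵐ ω ∂μ, p ≤ (μ[A.indicator (fun _ => (1 : ℝ))|m]) ω) :
    p * ∫ ω, f ω ∂μ ≤ ∫ ω, f ω * A.indicator (fun _ => (1 : ℝ)) ω ∂μ := by
  have hfi : Integrable f μ := integrable_of_mem_Icc (hf.mono hm le_rfl) h0 h1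
  have hgi : Integrable (A.indicator fun _ => (1 : ℝ)) μ := (integrable_const _).indicator hA
  have hfg : Integrable (f * A.indicator fun _ => (1 : ℝ)) μ :=
    hgi.bdd_mul (c := 1) (hf.mono hm le_rfl).aestronglyMeasurable
      (Eventually.of_forall fun ω => by rw [Real.norm_of_nonneg (h0 ω)]; exact h1 ω)
  have hpull := condExp_mul_of_stronglyMeasurable_left (Measurable.stronglyMeasurable hf) hfg hgi
  calc p * ∫ ω, f ω ∂μ = ∫ ω, f ω * p ∂μ := by rw [integral_mul_const, mul_comm]
    _ ≤ ∫ ω, (μ[f * A.indicator (fun _ => (1 : ℝ))|m]) ω ∂μ := by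
      refine integral_mono_ae (hfi.mul_const _) integrable_condExp ?_
      filter_upwards [h, hpull] with ω hω hp
      rw [hp]
      exact mul_le_mul_of_nonneg_left hω (h0 ω)
    _ = _ := by rw [integral_condExp hm]; rfl

/-- A lower tail bound for the number of events with conditional probability at least `p`. -/
theorem measureReal_eventCount_lt_le {F : ℕ → MeasurableSpace Ω} (hF : Monotone F)
    (hle : ∀ i, F i ≤ mΩ) {A : ℕ → Set Ω} (hA : ∀ i, MeasurableSet[F (i + 1)] (A i)) {p : ℝ}
    (hp1 : p ≤ 1)
    (h : ∀ i, ∀ᵐ ω ∂μ, p ≤ (μ[(A i).indicator (fun _ => (1 : ℝ))|F i]) ω) (n N : ℕ) :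
    μ.real {ω | eventCount A n ω < N} ≤ 2 ^ N * (1 - p / 2) ^ n := by
  have hmeas : ∀ n, Measurable[F n] fun ω => ((1 : ℝ) / 2) ^ eventCount A n ω := fun n =>
    (Measurable.of_discrete (f := fun k : ℕ => ((1 : ℝ) / 2) ^ k)).comp
      (measurable_eventCount fun i hi => hF (Nat.succ_le_of_lt hi) _ (hA i))
  have h0 : ∀ n ω, 0 ≤ ((1 : ℝ) / 2) ^ eventCount A n ω := fun n ω => by positivity
  have h1 : ∀ n ω, ((1 : ℝ) / 2) ^ eventCount A n ω ≤ 1 := fun n ω =>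
    pow_le_one₀ (by norm_num) (by norm_num)
  have hint : ∀ n, Integrable (fun ω => ((1 : ℝ) / 2) ^ eventCount A n ω) μ := fun n =>
    integrable_of_mem_Icc ((hmeas n).mono (hle n) le_rfl) (h0 n) (h1 n)
  -- Each event halves the weight and has conditional probability at least `p`, so the mean weight
  -- shrinks by a factor of at most `1 - p / 2` per step. Markov's inequality then gives the tail.
  have hE : ∀ n, ∫ ω, ((1 : ℝ) / 2) ^ eventCount A n ω ∂μ ≤ (1 - p / 2) ^ n := by
    intro n
    induction n with
    | zero => simp [eventCount]
    | succ n ih =>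
      have hAm := hle _ _ (hA n)
      have hi : Integrable (fun ω => ((1 : ℝ) / 2) ^ eventCount A n ω *
          (A n).indicator (fun _ => (1 : ℝ)) ω) μ :=
        ((integrable_const (1 : ℝ)).indicator hAm).bdd_mul (c := 1)
          (hint n).aestronglyMeasurable (Eventually.of_forall fun ω => by
            rw [Real.norm_of_nonneg (h0 n ω)]; exact h1 n ω)
      have hstep : ∀ ω, ((1 : ℝ) / 2) ^ eventCount A (n + 1) ω =
          (1 / 2) ^ eventCount A n ω - 1 / 2 * ((1 / 2) ^ eventCount A n ω *
            (A n).indicator (fun _ => (1 : ℝ)) ω) := by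
        intro ω
        by_cases hω : ω ∈ A n
        · rw [eventCount_succ_of_mem hω, Set.indicator_of_mem hω]; ring
        · rw [eventCount_succ_of_notMem hω, Set.indicator_of_notMem hω]; ring
      have hlow := mul_integral_le_integral_mul_indicator (hle n) (hmeas n) (h0 n) (h1 n) hAm (h n)
      calc ∫ ω, ((1 : ℝ) / 2) ^ eventCount A (n + 1) ω ∂μ
          = (∫ ω, ((1 : ℝ) / 2) ^ eventCount A n ω ∂μ) - 1 / 2 *
            ∫ ω, ((1 : ℝ) / 2) ^ eventCount A n ω * (A n).indicator (fun _ => (1 : ℝ)) ω ∂μ := by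
            simp_rw [hstep]
            rw [integral_sub (hint n) (hi.const_mul _), integral_const_mul]
        _ ≤ (1 - p / 2) * ∫ ω, ((1 : ℝ) / 2) ^ eventCount A n ω ∂μ := by linarith
        _ ≤ (1 - p / 2) * (1 - p / 2) ^ n := mul_le_mul_of_nonneg_left ih (by linarith)
        _ = _ := by ring
  have hmarkov := mul_meas_ge_le_integral_of_nonneg (μ := μ)
    (Eventually.of_forall (h0 n)) (hint n) ((1 / 2 : ℝ) ^ N)
  have hsub : {ω | eventCount A n ω < N} ⊆
      {ω | (1 / 2 : ℝ) ^ N ≤ (1 / 2 : ℝ) ^ eventCount A n ω} := fun ω hω =>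
    pow_le_pow_of_le_one (a := (1 / 2 : ℝ)) (by norm_num) (by norm_num) (le_of_lt hω)
  have h2 : (1 / 2 : ℝ) ^ N * μ.real {ω | eventCount A n ω < N} ≤ (1 - p / 2) ^ n :=
    (mul_le_mul_of_nonneg_left (measureReal_mono hsub) (by positivity)).trans
      (hmarkov.trans (hE n))
  calc μ.real {ω | eventCount A n ω < N}
      = 2 ^ N * ((1 / 2 : ℝ) ^ N * μ.real {ω | eventCount A n ω < N}) := by
        rw [← mul_assoc, ← mul_pow]; norm_num
    _ ≤ _ := mul_le_mul_of_nonneg_left h2 (by positivity)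

/-- Integrating an `m`-measurable weight over the complement of an independent event. -/
theorem integral_mul_indicator_compl_le {m' : MeasurableSpace Ω} (hm : m ≤ mΩ) (hm' : m' ≤ mΩ)
    (hind : Indep m m' μ) {f : Ω → ℝ} (hf : Measurable[m] f) (h0 : ∀ ω, 0 ≤ f ω)
    {B : Set Ω} (hB : MeasurableSet[m'] B) {q : ℝ} (hq : q ≤ μ.real B) :
    ∫ ω, f ω * Bᶜ.indicator (fun _ => (1 : ℝ)) ω ∂μ ≤ (1 - q) * ∫ ω, f ω ∂μ := by
  have hBm := hm' _ hB
  have hg : Measurable[m'] (Bᶜ.indicator fun _ => (1 : ℝ)) :=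
    Measurable.indicator (m := m') (@measurable_const _ _ _ m' 1)
      (@MeasurableSet.compl _ _ m' hB)
  have hfg : IndepFun f (Bᶜ.indicator fun _ => (1 : ℝ)) μ := by
    rw [IndepFun_iff_Indep]
    exact indep_of_indep_of_le_left (indep_of_indep_of_le_right hind hg.comap_le) hf.comap_le
  rw [hfg.integral_fun_mul_eq_mul_integral (hf.mono hm le_rfl).aestronglyMeasurable
    (hg.mono hm' le_rfl).aestronglyMeasurable, integral_indicator_const _ hBm.compl,
    probReal_compl_eq_one_sub hBm, smul_eq_mul, mul_one, mul_comm]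
  exact mul_le_mul_of_nonneg_right (by linarith) (integral_nonneg h0)

/-- The event that none of the first `n` events `A i ∩ K i` and `A' i ∩ K' i` occurs. -/
def survival {Ω : Type*} (A A' K K' : ℕ → Set Ω) (n : ℕ) : Set Ω :=
  ⋂ i ∈ Finset.range n, ((A i ∩ K i)ᶜ ∩ (A' i ∩ K' i)ᶜ)

/-- Whenever one of the disjoint events `A i`, `A' i` occurs, an independent event of probability
at least `q` has to be avoided; surviving `N` such occasions has probability at most
`(1 - q) ^ N`. -/
theorem measureReal_survival_le {G : ℕ → MeasurableSpace Ω} (hG : Monotone G)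
    (hle : ∀ i, G i ≤ mΩ) {A A' K K' : ℕ → Set Ω} (hA : ∀ i, MeasurableSet[G i] (A i))
    (hA' : ∀ i, MeasurableSet[G i] (A' i)) (hdisj : ∀ i, Disjoint (A i) (A' i))
    {m' : ℕ → MeasurableSpace Ω} (hm' : ∀ i, m' i ≤ G (i + 1))
    (hind : ∀ i, Indep (G i) (m' i) μ) (hK : ∀ i, MeasurableSet[m' i] (K i))
    (hK' : ∀ i, MeasurableSet[m' i] (K' i)) {q : ℝ} (hq0 : 0 ≤ q) (hq1 : q ≤ 1)
    (hqK : ∀ i, q ≤ μ.real (K i)) (hqK' : ∀ i, q ≤ μ.real (K' i)) (n N : ℕ) :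
    μ.real (survival A A' K K' n ∩ {ω | N ≤ eventCount (fun i => A i ∪ A' i) n ω}) ≤
      (1 - q) ^ N := by
  set c : ℕ → Ω → ℕ := eventCount fun i => A i ∪ A' i with hc
  have hq : 0 ≤ 1 - q := by linarith
  have hcm : ∀ n, Measurable[G n] (c n) := fun n => measurable_eventCount fun i hi =>
    @MeasurableSet.union _ (G n) _ _ (hG hi.le _ (hA i)) (hG hi.le _ (hA' i))
  have hSm : ∀ n, MeasurableSet[G n] (survival A A' K K' n) := fun n =>
    @Finset.measurableSet_biInter _ _ (G n) _ _ fun i hi => by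
      have hi := Finset.mem_range.1 hi
      have h1 := hG hi.le _ (hA i)
      have h2 := hG hi.le _ (hA' i)
      have h3 := hG (Nat.succ_le_of_lt hi) _ (hm' i _ (hK i))
      have h4 := hG (Nat.succ_le_of_lt hi) _ (hm' i _ (hK' i))
      exact @MeasurableSet.inter _ (G n) _ _
        (@MeasurableSet.compl _ _ (G n) (@MeasurableSet.inter _ (G n) _ _ h1 h3))
        (@MeasurableSet.compl _ _ (G n) (@MeasurableSet.inter _ (G n) _ _ h2 h4))
  let I : Set Ω → Ω → ℝ := fun s => s.indicator fun _ => 1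
  have hI0 : ∀ s ω, 0 ≤ I s ω := fun s ω => Set.indicator_nonneg (fun _ _ => zero_le_one) ω
  have hI1 : ∀ s ω, I s ω ≤ 1 := fun s ω => Set.indicator_le_self' (by simp) ω
  have hIm : ∀ {m₀ : MeasurableSpace Ω} {s : Set Ω}, MeasurableSet[m₀] s → Measurable[m₀] (I s) :=
    fun {m₀ s} hs => Measurable.indicator (m := m₀) (@measurable_const _ _ _ m₀ 1) hs
  -- `W n 0` is a supermartingale: the survival indicator times `(1 - q)` to the number of occasions
  -- still missing. The truncated subtraction stops the exponent at zero, so `W n 0 = 1` on survival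
  -- with at least `N` occasions. The parameter `k = 1` counts in advance an occasion at step `n`;
  -- the independent factor `1 - q` pays for it.
  let W : ℕ → ℕ → Ω → ℝ := fun n k ω => I (survival A A' K K' n) ω * (1 - q) ^ (N - (c n ω + k))
  have hW0 : ∀ n k ω, 0 ≤ W n k ω := fun n k ω => mul_nonneg (hI0 _ _) (pow_nonneg hq _)
  have hW1 : ∀ n k ω, W n k ω ≤ 1 := fun n k ω =>
    mul_le_one₀ (hI1 _ _) (pow_nonneg hq _) (pow_le_one₀ hq (by linarith))
  have hWm : ∀ n k, Measurable[G n] (W n k) := fun n k =>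
    Measurable.mul (hIm (hSm n)) ((Measurable.of_discrete
      (f := fun j : ℕ => (1 - q) ^ (N - (j + k)))).comp (hcm n))
  have hprod : ∀ {f g : Ω → ℝ}, Measurable f → Measurable g → (∀ ω, 0 ≤ f ω) → (∀ ω, 0 ≤ g ω) →
      (∀ ω, f ω ≤ 1) → (∀ ω, g ω ≤ 1) → Integrable (fun ω => f ω * g ω) μ :=
    fun hf hg h0 h0' h1 h1' => integrable_of_mem_Icc (hf.mul hg)
      (fun ω => mul_nonneg (h0 ω) (h0' ω)) fun ω => mul_le_one₀ (h1 ω) (h0' ω) (h1' ω)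
  have hstep : ∀ n ω, W (n + 1) 0 ω ≤ W n 0 ω * I (A n ∪ A' n)ᶜ ω +
      W n 1 ω * I (A n) ω * I (K n)ᶜ ω + W n 1 ω * I (A' n) ω * I (K' n)ᶜ ω := by
    intro n ω
    have hsurv : survival A A' K K' (n + 1) =
        survival A A' K K' n ∩ ((A n ∩ K n)ᶜ ∩ (A' n ∩ K' n)ᶜ) := by
      simp only [survival, Finset.range_add_one, Finset.set_biInter_insert, Set.inter_comm]
    have hSle : I (survival A A' K K' (n + 1)) ω ≤ I (survival A A' K K' n) ω :=
      Set.indicator_le_indicator_of_subset (hsurv ▸ Set.inter_subset_left)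
        (fun _ => zero_le_one) ω
    by_cases h1 : ω ∈ A n
    · have h2 : ω ∉ A' n := fun h2 => Set.disjoint_left.1 (hdisj n) h1 h2
      have hcount : c (n + 1) ω = c n ω + 1 := eventCount_succ_of_mem (Or.inl h1)
      by_cases h3 : ω ∈ K n
      · have : ω ∉ survival A A' K K' (n + 1) := by
          rw [hsurv]; exact fun hmem => hmem.2.1 ⟨h1, h3⟩
        simp [W, I, h1, h2, h3, this]
      · simp only [W, I, hcount] at hSle ⊢
        simpa [h1, h2, h3] using mul_le_mul_of_nonneg_right hSle (pow_nonneg hq _)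
    · by_cases h2 : ω ∈ A' n
      · have hcount : c (n + 1) ω = c n ω + 1 := eventCount_succ_of_mem (Or.inr h2)
        by_cases h3 : ω ∈ K' n
        · have : ω ∉ survival A A' K K' (n + 1) := by
            rw [hsurv]; exact fun hmem => hmem.2.2 ⟨h2, h3⟩
          simp [W, I, h1, h2, h3, this]
        · simp only [W, I, hcount] at hSle ⊢
          simpa [h1, h2, h3] using mul_le_mul_of_nonneg_right hSle (pow_nonneg hq _)
      · have hcount : c (n + 1) ω = c n ω :=
          eventCount_succ_of_notMem (by rintro (h | h); exacts [h1 h, h2 h])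
        simp only [W, I, hcount] at hSle ⊢
        simpa [h1, h2] using mul_le_mul_of_nonneg_right hSle (pow_nonneg hq _)
  have hone : ∀ n ω, (1 - q) * W n 1 ω ≤ W n 0 ω := by
    intro n ω
    have : (1 - q) * (1 - q) ^ (N - (c n ω + 1)) ≤ (1 - q) ^ (N - (c n ω + 0)) := by
      rw [← pow_succ']
      exact pow_le_pow_of_le_one hq (by linarith) (by omega)
    calc (1 - q) * W n 1 ω = I (survival A A' K K' n) ω *
          ((1 - q) * (1 - q) ^ (N - (c n ω + 1))) := by simp only [W]; ring
      _ ≤ _ := mul_le_mul_of_nonneg_left this (hI0 _ _)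
  have hE : ∀ n, ∫ ω, W n 0 ω ∂μ ≤ (1 - q) ^ N := by
    intro n
    induction n with
    | zero =>
      refine (integral_mono (g := fun _ => (1 - q) ^ N) (integrable_of_mem_Icc
        ((hWm 0 0).mono (hle 0) le_rfl) (hW0 0 0) (hW1 0 0)) (integrable_const _) fun ω => ?_).trans
        (by simp)
      have hz : c 0 ω = 0 := by simp [hc, eventCount]
      simp only [W, hz, add_zero, Nat.sub_zero]
      exact mul_le_of_le_one_left (pow_nonneg hq _) (hI1 _ _)
    | succ n ih =>
      have hAn := hle _ _ (hA n)
      have hAn' := hle _ _ (hA' n)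
      have hKn := hle _ _ (hm' n _ (hK n))
      have hKn' := hle _ _ (hm' n _ (hK' n))
      have hm0 := fun k => (hWm n k).mono (hle n) le_rfl
      have hb1 : ∀ s ω, W n 1 ω * I s ω ≤ 1 := fun s ω =>
        mul_le_one₀ (hW1 n 1 ω) (hI0 _ _) (hI1 _ _)
      have hb0 : ∀ s ω, 0 ≤ W n 1 ω * I s ω := fun s ω => mul_nonneg (hW0 n 1 ω) (hI0 _ _)
      have i0 : ∀ s, MeasurableSet s → Integrable (fun ω => W n 0 ω * I s ω) μ := fun s hs =>
        hprod (hm0 0) (hIm hs) (hW0 n 0) (hI0 _) (hW1 n 0) (hI1 _)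
      have i1 : ∀ s, MeasurableSet s → Integrable (fun ω => W n 1 ω * I s ω) μ := fun s hs =>
        hprod (hm0 1) (hIm hs) (hW0 n 1) (hI0 _) (hW1 n 1) (hI1 _)
      have i2 : ∀ s t, MeasurableSet s → MeasurableSet t →
          Integrable (fun ω => W n 1 ω * I s ω * I t ω) μ := fun s t hs ht =>
        hprod ((hm0 1).mul (hIm hs)) (hIm ht) (hb0 s) (hI0 _) (hb1 s) (hI1 _)
      have hm'' : m' n ≤ mΩ := (hm' n).trans (hle _)
      have e1 := integral_mul_indicator_compl_le (hle n) hm'' (hind n)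
        (f := fun ω => W n 1 ω * I (A n) ω) (Measurable.mul (hWm n 1) (hIm (hA n)))
        (hb0 _) (hK n) (hqK n)
      have e2 := integral_mul_indicator_compl_le (hle n) hm'' (hind n)
        (f := fun ω => W n 1 ω * I (A' n) ω) (Measurable.mul (hWm n 1) (hIm (hA' n)))
        (hb0 _) (hK' n) (hqK' n)
      have b : ∀ s, MeasurableSet s → (1 - q) * ∫ ω, W n 1 ω * I s ω ∂μ ≤
          ∫ ω, W n 0 ω * I s ω ∂μ := fun s hs => by
        rw [← integral_const_mul]
        refine integral_mono ((i1 s hs).const_mul _) (i0 s hs) fun ω => ?_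
        simp only [← mul_assoc]
        exact mul_le_mul_of_nonneg_right (hone n ω) (hI0 _ _)
      calc ∫ ω, W (n + 1) 0 ω ∂μ
          ≤ ∫ ω, (W n 0 ω * I (A n ∪ A' n)ᶜ ω + W n 1 ω * I (A n) ω * I (K n)ᶜ ω +
              W n 1 ω * I (A' n) ω * I (K' n)ᶜ ω) ∂μ :=
            integral_mono (integrable_of_mem_Icc ((hWm (n + 1) 0).mono (hle _) le_rfl)
              (hW0 _ _) (hW1 _ _)) (((i0 _ (hAn.union hAn').compl).add
                (i2 _ _ hAn hKn.compl)).add (i2 _ _ hAn' hKn'.compl)) (hstep n)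
        _ = (∫ ω, W n 0 ω * I (A n ∪ A' n)ᶜ ω ∂μ) + (∫ ω, W n 1 ω * I (A n) ω * I (K n)ᶜ ω ∂μ) +
              ∫ ω, W n 1 ω * I (A' n) ω * I (K' n)ᶜ ω ∂μ :=
            integral_add_three (i0 _ (hAn.union hAn').compl) (i2 _ _ hAn hKn.compl)
              (i2 _ _ hAn' hKn'.compl)
        _ ≤ (∫ ω, W n 0 ω * I (A n ∪ A' n)ᶜ ω ∂μ) + (∫ ω, W n 0 ω * I (A n) ω ∂μ) +
              ∫ ω, W n 0 ω * I (A' n) ω ∂μ :=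
            add_le_add (add_le_add le_rfl (e1.trans (b _ hAn))) (e2.trans (b _ hAn'))
        _ = ∫ ω, W n 0 ω ∂μ := by
            rw [← integral_add_three (i0 _ (hAn.union hAn').compl) (i0 _ hAn) (i0 _ hAn')]
            congr 1 with ω
            by_cases h1 : ω ∈ A n
            · have h2 : ω ∉ A' n := fun h2 => Set.disjoint_left.1 (hdisj n) h1 h2
              simp [I, h1, h2]
            · by_cases h2 : ω ∈ A' n <;> simp [I, h1, h2]
        _ ≤ _ := ih
  have hmeas : MeasurableSet[mΩ] (survival A A' K K' n ∩ {ω | N ≤ c n ω}) :=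
    (hle n _ (hSm n)).inter (((hcm n).mono (hle n) le_rfl) measurableSet_Ici)
  refine le_trans ?_ (hE n)
  rw [← integral_indicator_one hmeas]
  refine integral_mono ((integrable_const (1 : ℝ)).indicator hmeas) (integrable_of_mem_Icc
    ((hWm n 0).mono (hle n) le_rfl) (hW0 n 0) (hW1 n 0)) fun ω => ?_
  by_cases hω : ω ∈ survival A A' K K' n ∩ {ω | N ≤ c n ω}
  · have h2 : N - c n ω = 0 := Nat.sub_eq_zero_of_le hω.2
    simp [hω, W, I, hω.1, h2]
  · rw [Set.indicator_of_notMem hω]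
    exact hW0 n 0 ω

end Counting

/-! ### From a large diameter to an error direction, and the union bound. -/

section Diameter

open scoped Matrix.Norms.Frobenius in
/-- A matrix of large Frobenius norm has a long row. -/
theorem exists_row_norm_gt {n k : ℕ} {D : Matrix (Fin n) (Fin k) ℝ} {δ : ℝ} (hδ : 0 < δ)
    (hD : δ / 2 < ‖D‖) : ∃ j, δ / (2 * √(n : ℝ)) < ‖(WithLp.toLp 2 (D j) : Vec k)‖ := by
  by_contra! hcon
  refine hD.not_ge ?_
  rw [Matrix.frobenius_norm_def, ← Real.sqrt_eq_rpow]
  refine Real.sqrt_le_iff.2 ⟨by positivity, ?_⟩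
  have hrow : ∀ i, ∑ j, ‖D i j‖ ^ (2 : ℝ) ≤ (δ / (2 * √(n : ℝ))) ^ 2 := fun i => by
    have h1 := pow_le_pow_left₀ (norm_nonneg _) (hcon i) 2
    rw [EuclideanSpace.real_norm_sq_eq] at h1
    simpa using h1
  refine (Finset.sum_le_sum fun i _ => hrow i).trans ?_
  rw [Finset.sum_const, Finset.card_univ, Fintype.card_fin, nsmul_eq_mul]
  rcases Nat.eq_zero_or_pos n with rfl | hn
  · simp; positivity
  · have : (0 : ℝ) < n := by exact_mod_cast hn
    rw [div_pow, mul_pow, Real.sq_sqrt this.le]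
    apply le_of_eq
    field_simp

open scoped Matrix.Norms.Frobenius in
-- Otherwise the set lies in a ball of radius `δ / 2` around `θ` and has diameter at most `δ`.
theorem exists_norm_sub_gt_of_lt_frobDiam {n k : ℕ} {S : Set (Matrix (Fin n) (Fin k) ℝ)} {δ : ℝ}
    (hS : ENNReal.ofReal δ < frobDiam S) (θ : Matrix (Fin n) (Fin k) ℝ) :
    ∃ θ' ∈ S, δ / 2 < ‖θ' - θ‖ := by
  by_contra! hcon
  refine hS.not_ge (Metric.ediam_le fun a ha c hc => ?_)
  rw [edist_dist]
  refine ENNReal.ofReal_le_ofReal ?_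
  rw [dist_eq_norm]
  calc ‖a - c‖ = ‖(a - θ) - (c - θ)‖ := by rw [sub_sub_sub_cancel_right]
    _ ≤ ‖a - θ‖ + ‖c - θ‖ := norm_sub_le _ _
    _ ≤ δ := by linarith [hcon a ha, hcon c hc]

variable {Ω : Type*} [mΩ : MeasurableSpace Ω] {μ : Measure Ω}
  {nx nu nφ : ℕ} {θ : Matrix (Fin nx) (Fin nφ) ℝ} {φ : Vec nx × Vec nu → Vec nφ}
  {π : Vec nx → Vec nu} {w : ℕ → Ω → Vec nx} {η : ℕ → Ω → Vec nu} {x : ℕ → Ω → Vec nx}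
  {wmax umax ρx ρ : ℝ} {qw : ℝ → ℝ}

theorem abs_apply_le_linfNorm {n : ℕ} (v : Vec n) (j : Fin n) : |v j| ≤ linfNorm v :=
  norm_le_pi_norm (WithLp.ofLp v) j

namespace IsClosedLoopSystem

/-- If the set-membership estimate has a large diameter, then some row has an error direction which
is compatible with all the disturbances. -/
theorem exists_direction_of_lt_frobDiam
    (h : IsClosedLoopSystem μ θ φ π w η x wmax umax ρx ρ qw) {T : ℕ} {δ : ℝ} (hδ : 0 < δ) {ω : Ω}
    (hw : ∀ t, linfNorm (w t ω) ≤ wmax)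
    (hdiam : ENNReal.ofReal δ < frobDiam (smeSet wmax x (features φ π η x) T ω)) :
    ∃ (u : Vec nφ) (j : Fin nx), ‖u‖ = 1 ∧ ∀ t < T,
      |w t ω j - δ / (2 * √(nx : ℝ)) * inner ℝ u (features φ π η x t ω)| ≤ wmax := by
  obtain ⟨θ', hθ', hnorm⟩ := exists_norm_sub_gt_of_lt_frobDiam hdiam θ
  obtain ⟨j, hj⟩ := exists_row_norm_gt hδ hnorm
  set r := δ / (2 * √(nx : ℝ)) with hr
  set g : Vec nφ := WithLp.toLp 2 ((θ' - θ) j) with hg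
  have hr0 : 0 ≤ r := by positivity
  have hg0 : 0 < ‖g‖ := hr0.trans_lt hj
  refine ⟨‖g‖⁻¹ • g, j, by rw [norm_smul, norm_inv, norm_norm, inv_mul_cancel₀ hg0.ne'],
    fun t ht => ?_⟩
  have h1 : |w t ω j - inner ℝ g (features φ π η x t ω)| ≤ wmax := by
    have hmem := Set.mem_iInter₂.1 hθ' t (Finset.mem_range.2 ht)
    refine le_trans (le_of_eq ?_) ((abs_apply_le_linfNorm _ j).trans hmem)
    congr 1
    have hin : inner ℝ g (features φ π η x t ω) =
        (θ' *ᵥ (features φ π η x t ω).ofLp) j - (θ *ᵥ (features φ π η x t ω).ofLp) j := by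
      rw [← Pi.sub_apply, ← Matrix.sub_mulVec]
      simp only [hg, PiLp.inner_apply, RCLike.inner_apply, conj_trivial, Matrix.mulVec, dotProduct,
        mul_comm]
    rw [h.step t ω, hin]
    simp only [linResp, PiLp.sub_apply, PiLp.add_apply]
    ring
  have h2 : |w t ω j| ≤ wmax := (abs_apply_le_linfNorm _ j).trans (hw t)
  -- Both the zero error and the error `g` are compatible with the disturbance bound, hence so is
  -- the convex combination of length exactly `r`.
  set c := r / ‖g‖ with hc
  have hc0 : 0 ≤ c := by positivity
  have hc1 : c ≤ 1 := (div_le_one hg0).2 hj.le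
  have h3 : r * inner ℝ (‖g‖⁻¹ • g) (features φ π η x t ω) =
      c * inner ℝ g (features φ π η x t ω) := by
    rw [real_inner_smul_left, hc]; ring
  rw [h3]
  have h4 : w t ω j - c * inner ℝ g (features φ π η x t ω) =
      (1 - c) * w t ω j + c * (w t ω j - inner ℝ g (features φ π η x t ω)) := by ring
  rw [h4]
  calc _ ≤ |(1 - c) * w t ω j| + |c * (w t ω j - inner ℝ g (features φ π η x t ω))| :=
        abs_add_le _ _
    _ = (1 - c) * |w t ω j| + c * |w t ω j - inner ℝ g (features φ π η x t ω)| := by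
        rw [abs_mul, abs_mul, abs_of_nonneg hc0, abs_of_nonneg (by linarith)]
    _ ≤ (1 - c) * wmax + c * wmax :=
        add_le_add (mul_le_mul_of_nonneg_left h2 (by linarith)) (mul_le_mul_of_nonneg_left h1 hc0)
    _ = wmax := by ring

end IsClosedLoopSystem

/-- The small-ball condition with `k = 1` and `Γ = s² I`. -/
theorem IsBMSB.le_condExp {F : ℕ → MeasurableSpace Ω} {n : ℕ} {y : ℕ → Ω → Vec n} {s p : ℝ}
    (hs : 0 < s) (hB : IsBMSB μ F y 1 ((s ^ 2) • (1 : Matrix (Fin n) (Fin n) ℝ)) p)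
    {v : Vec n} (hv : ‖v‖ = 1) {t : ℕ} (ht : 1 ≤ t) :
    ∀ᵐ ω ∂μ, p ≤ (μ[Set.indicator {ω | s ≤ |inner ℝ v (y (t + 1) ω)|}
      (fun _ => (1 : ℝ))|F t]) ω := by
  have := hB.smallBall v hv t ht
  simp only [sqrt_dotProduct_smul_one_mulVec hs hv] at this
  simpa using this

/-- The unconditional small-ball probability. -/
theorem IsBMSB.le_measureReal [IsProbabilityMeasure μ] {F : ℕ → MeasurableSpace Ω} {n : ℕ}
    {y : ℕ → Ω → Vec n} {s p : ℝ} (hs : 0 < s)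
    (hB : IsBMSB μ F y 1 ((s ^ 2) • (1 : Matrix (Fin n) (Fin n) ℝ)) p)
    {v : Vec n} (hv : ‖v‖ = 1) : p ≤ μ.real {ω | s ≤ |inner ℝ v (y 2 ω)|} := by
  have hy : Measurable (y 2) := (hB.adapted 2 (by norm_num)).mono (hB.le 2 (by norm_num)) le_rfl
  have hm : MeasurableSet {ω | s ≤ |inner ℝ v (y 2 ω)|} :=
    measurableSet_le measurable_const (continuous_abs.measurable.comp (hy.const_inner))
  have h1 : ∫ _, p ∂μ ≤ ∫ ω, (μ[Set.indicator {ω | s ≤ |inner ℝ v (y 2 ω)|}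
      (fun _ => (1 : ℝ))|F 1]) ω ∂μ :=
    integral_mono_ae (integrable_const _) integrable_condExp (hB.le_condExp hs hv le_rfl)
  rw [integral_condExp (hB.le 1 le_rfl), integral_indicator_const _ hm] at h1
  simpa using h1

/-- The small-ball condition in all coordinate directions bounds the dimension. -/
theorem IsBMSB.dim_mul_le [IsProbabilityMeasure μ] {F : ℕ → MeasurableSpace Ω} {n : ℕ}
    {y : ℕ → Ω → Vec n} {s p b : ℝ} (hs : 0 < s)
    (hB : IsBMSB μ F y 1 ((s ^ 2) • (1 : Matrix (Fin n) (Fin n) ℝ)) p)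
    (hb : ∀ᵐ ω ∂μ, ‖y 2 ω‖ ≤ b) : n * (s ^ 2 * p) ≤ b ^ 2 := by
  have hy : Measurable (y 2) := (hB.adapted 2 (by norm_num)).mono (hB.le 2 (by norm_num)) le_rfl
  let e : Fin n → Vec n := fun i => EuclideanSpace.single i 1
  have he : ∀ i, ‖e i‖ = 1 := fun i => by simp [e]
  have hm : ∀ i, MeasurableSet {ω | s ≤ |inner ℝ (e i) (y 2 ω)|} := fun i =>
    measurableSet_le measurable_const (continuous_abs.measurable.comp (hy.const_inner))
  have hint : ∀ i, Integrable (fun ω => {ω | s ≤ |inner ℝ (e i) (y 2 ω)|}.indicator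
      (fun _ => s ^ 2) ω) μ := fun i => (integrable_const _).indicator (hm i)
  -- Each coordinate of size at least `s` contributes at least `s ^ 2` to the squared norm, and each
  -- is that large with probability at least `p`.
  have h1 : ∫ ω, ∑ i, {ω | s ≤ |inner ℝ (e i) (y 2 ω)|}.indicator (fun _ => s ^ 2) ω ∂μ ≤
      ∫ _, b ^ 2 ∂μ := by
    refine integral_mono_ae (integrable_finsetSum _ fun i _ => hint i) (integrable_const _) ?_
    filter_upwards [hb] with ω hω
    refine le_trans ?_ (pow_le_pow_left₀ (norm_nonneg _) hω 2)
    rw [EuclideanSpace.real_norm_sq_eq]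
    refine Finset.sum_le_sum fun i _ => ?_
    refine Set.indicator_apply_le' (fun hi => ?_) fun _ => sq_nonneg _
    have hi' : s ≤ |y 2 ω i| := by
      simpa [e, EuclideanSpace.inner_single_left] using hi
    calc s ^ 2 ≤ |y 2 ω i| ^ 2 := pow_le_pow_left₀ hs.le hi' 2
      _ = _ := sq_abs _
  rw [integral_finsetSum _ fun i _ => hint i] at h1
  simp only [integral_indicator_const _ (hm _), integral_const, probReal_univ, smul_eq_mul,
    one_mul] at h1
  refine le_trans ?_ h1
  calc (n : ℝ) * (s ^ 2 * p) = ∑ _i : Fin n, s ^ 2 * p := by simp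
    _ ≤ _ := Finset.sum_le_sum fun i _ => by
      rw [mul_comm]
      exact mul_le_mul_of_nonneg_right (hB.le_measureReal hs (he i)) (sq_nonneg s)

/-- A bound on the features dominates the small-ball radius. -/
theorem IsBMSB.le_bound [IsProbabilityMeasure μ] {F : ℕ → MeasurableSpace Ω} {n : ℕ} (hn : 0 < n)
    {y : ℕ → Ω → Vec n} {s p b : ℝ} (hs : 0 < s) (hp : 0 < p)
    (hB : IsBMSB μ F y 1 ((s ^ 2) • (1 : Matrix (Fin n) (Fin n) ℝ)) p)
    (hb : ∀ᵐ ω ∂μ, ‖y 2 ω‖ ≤ b) : s ≤ b := by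
  have hv : ‖(EuclideanSpace.single ⟨0, hn⟩ 1 : Vec n)‖ = 1 := by simp
  by_contra! hlt
  have h0 : μ {ω | s ≤ |inner ℝ (EuclideanSpace.single ⟨0, hn⟩ 1 : Vec n) (y 2 ω)|} = 0 := by
    refine measure_mono_null ?_ (ae_iff.1 hb)
    intro ω hω hle
    have h1 := abs_real_inner_le_norm (EuclideanSpace.single ⟨0, hn⟩ 1 : Vec n) (y 2 ω)
    rw [hv, one_mul] at h1
    exact hlt.not_ge ((show s ≤ _ from hω).trans (h1.trans hle))
  have h1 := hB.le_measureReal hs hv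
  rw [measureReal_def, h0] at h1
  simp at h1
  linarith

/-- The probability that the set-membership estimate after `n + 2` steps has a large diameter, in
terms of a net of the unit sphere and of a number `N` of excited time steps. -/
theorem IsClosedLoopSystem.measureReal_lt_frobDiam_le [IsProbabilityMeasure μ]
    (h : IsClosedLoopSystem μ θ φ π w η x wmax umax ρx ρ qw) (hnx : 0 < nx) (hnφ : 0 < nφ)
    {s p b : ℝ} (hs : 0 < s) (hp : 0 < p) (hp1 : p < 1)
    (hB : IsBMSB μ (history π w η x) (features φ π η x) 1
      ((s ^ 2) • (1 : Matrix (Fin nφ) (Fin nφ) ℝ)) p)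
    (hb : ∀ t, ∀ᵐ ω ∂μ, ‖features φ π η x t ω‖ ≤ b) {δ ℓ q : ℝ} (hδ : 0 < δ)
    (hℓ : ℓ < s * δ / (16 * √(nx : ℝ))) (hq0 : 0 ≤ q) (hq1 : q ≤ 1)
    (hq : ∀ (j : Fin nx) (t : ℕ),
      q ≤ μ.real {ω | w t ω j + wmax ≤ ℓ} ∧ q ≤ μ.real {ω | wmax - w t ω j ≤ ℓ}) (n N : ℕ) :
    μ.real {ω | ENNReal.ofReal δ < frobDiam (smeSet wmax x (features φ π η x) (n + 2) ω)} ≤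
      (4 * b / s) ^ nφ * (2 ^ N * (1 - p / 2) ^ n) + nx * (4 * b / s) ^ nφ * (1 - q) ^ N := by
  classical
  have hsb : s ≤ b := hB.le_bound hnφ hs hp (hb 2)
  have hb0 : 0 < b := hs.trans_le hsb
  set y := features φ π η x with hy
  -- With this radius, replacing `u` by a net point changes the inner product with a feature vector
  -- by at most `7 s / 8`, so `s / 8` of the excitation survives.
  obtain ⟨V, hV1, hVnet, hVcard⟩ := exists_sphere_net (n := nφ) (ε := 7 * s / (8 * b))
    (by positivity)
  have hcard : (V.card : ℝ) ≤ (4 * b / s) ^ nφ := by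
    refine hVcard.trans (pow_le_pow_left₀ (by positivity) ?_ _)
    have : 1 ≤ b / s := (one_le_div hs).2 hsb
    have e1 : 2 / (7 * s / (8 * b)) = 16 / 7 * (b / s) := by field_simp; norm_num
    rw [e1, mul_div_assoc]
    linarith
  -- The small-ball condition starts with the history at time `1` and speaks of the next feature, so
  -- the first usable time is `2`. The `n` usable times are `2, …, n + 1`.
  let A : Vec nφ → ℕ → Set Ω := fun v i => {ω | s ≤ inner ℝ v (y (i + 2) ω)}
  let A' : Vec nφ → ℕ → Set Ω := fun v i => {ω | inner ℝ v (y (i + 2) ω) ≤ -s}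
  let K : Fin nx → ℕ → Set Ω := fun j i => {ω | w (i + 2) ω j + wmax ≤ ℓ}
  let K' : Fin nx → ℕ → Set Ω := fun j i => {ω | wmax - w (i + 2) ω j ≤ ℓ}
  let E : Vec nφ → Set Ω := fun v => {ω | eventCount (fun i => A v i ∪ A' v i) n ω < N}
  let S : Fin nx → Vec nφ → Set Ω := fun j v => survival (A v) (A' v) (K j) (K' j) n ∩
    {ω | N ≤ eventCount (fun i => A v i ∪ A' v i) n ω}
  have hyF : ∀ i, Measurable[history π w η x (i + 2)] (y (i + 2)) := fun i =>
    h.measurable_features_history le_rfl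
  have hyv : ∀ v i, Measurable[history π w η x (i + 2)] fun ω => (inner ℝ v (y (i + 2) ω) : ℝ) :=
    fun v i => (continuous_const.inner continuous_id).measurable.comp (hyF i)
  have hAm : ∀ v i, MeasurableSet[history π w η x (i + 2)] (A v i) := fun v i =>
    (hyv v i) measurableSet_Ici
  have hAm' : ∀ v i, MeasurableSet[history π w η x (i + 2)] (A' v i) := fun v i =>
    (hyv v i) measurableSet_Iic
  have hcoord : ∀ j : Fin nx, Measurable fun z : Vec nx => z j := fun j => by fun_prop
  have hE : ∀ v ∈ V, μ.real (E v) ≤ 2 ^ N * (1 - p / 2) ^ n := fun v hv =>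
    measureReal_eventCount_lt_le (F := fun i => history π w η x (i + 1))
      (fun _ _ hij => history_mono π w η x (Nat.succ_le_succ hij)) (fun i => h.history_le _)
      (fun i => @MeasurableSet.union _ (history π w η x (i + 2)) _ _ (hAm v i) (hAm' v i))
      hp1.le (fun i => by
        have := hB.le_condExp hs (hV1 v hv) (t := i + 1) (by omega)
        convert this using 5
        ext ω
        simp only [A, A', Set.mem_union, Set.mem_ofPred_eq, le_abs, hy]
        constructor <;> (rintro (h | h) <;> [left; right] <;> linarith)) n N
  have hS : ∀ j v, μ.real (S j v) ≤ (1 - q) ^ N := fun j v =>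
    measureReal_survival_le (G := fun i => history π w η x (i + 2))
      (fun _ _ hij => history_mono π w η x (Nat.succ_le_succ (Nat.succ_le_succ hij)))
      (fun i => h.history_le _) (hAm v) (hAm' v)
      (fun i => Set.disjoint_left.2 fun ω (h1 : s ≤ _) (h2 : _ ≤ -s) => by linarith)
      (m' := fun i => MeasurableSpace.comap (w (i + 2)) inferInstance)
      (fun i => (measurable_disturbance_history π w η x (Nat.lt_succ_self (i + 2))).comap_le)
      (fun i => h.indep_disturbance_history (i + 2))
      (fun i => ⟨{z | z j + wmax ≤ ℓ}, ((hcoord j).add_const _) measurableSet_Iic, rfl⟩)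
      (fun i => ⟨{z | wmax - z j ≤ ℓ}, ((hcoord j).const_sub _) measurableSet_Iic, rfl⟩)
      hq0 hq1 (fun i => (hq j _).1) (fun i => (hq j _).2) n N
  have hsub : {ω | ENNReal.ofReal δ < frobDiam (smeSet wmax x y (n + 2) ω)} ≤ᵐ[μ]
      ((⋃ v ∈ V, E v) ∪ ⋃ j ∈ (Finset.univ : Finset (Fin nx)), ⋃ v ∈ V, S j v : Set Ω) := by
    filter_upwards [ae_all_iff.2 h.disturbance.bounded, ae_all_iff.2 hb] with ω hw hyb hω
    obtain ⟨u, j, hu, hcomp⟩ := h.exists_direction_of_lt_frobDiam hδ hw hω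
    obtain ⟨v, hv, huv⟩ := hVnet u hu
    by_cases hcount : eventCount (fun i => A v i ∪ A' v i) n ω < N
    · exact Or.inl (Set.mem_iUnion₂.2 ⟨v, hv, hcount⟩)
    refine Or.inr (Set.mem_iUnion₂.2 ⟨j, Finset.mem_univ j, Set.mem_iUnion₂.2 ⟨v, hv, ?_,
      not_lt.1 hcount⟩⟩)
    set r := δ / (2 * √(nx : ℝ)) with hr
    have hsq : 0 < √(nx : ℝ) := Real.sqrt_pos.2 (by exact_mod_cast hnx)
    have hr0 : 0 < r := by positivity
    have hℓr : ℓ < r * (s / 8) := by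
      refine hℓ.trans_eq ?_
      rw [hr]; field_simp; norm_num
    refine Set.mem_iInter₂.2 fun i hi => ?_
    have hi := Finset.mem_range.1 hi
    have hc := abs_le.1 (hcomp (i + 2) (by omega))
    have hdiff : |(inner ℝ u (y (i + 2) ω) : ℝ) - inner ℝ v (y (i + 2) ω)| ≤ 7 * s / 8 := by
      rw [← inner_sub_left]
      refine (abs_real_inner_le_norm _ _).trans ((mul_le_mul huv (hyb (i + 2)) (norm_nonneg _)
        (by positivity)).trans_eq ?_)
      field_simp
    have hd := abs_le.1 hdiff
    constructor
    -- Compatibility forces the disturbance at least `r s / 8` above its lower endpoint. As `ℓ < r s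
    -- / 8` strictly, it cannot also be within `ℓ` of it. The other sign is symmetric.
    · rintro ⟨h1 : s ≤ _, h2 : w (i + 2) ω j + wmax ≤ ℓ⟩
      have : r * (s / 8) ≤ r * inner ℝ u (y (i + 2) ω) :=
        mul_le_mul_of_nonneg_left (by linarith) hr0.le
      linarith [hc.1]
    · rintro ⟨h1 : _ ≤ -s, h2 : wmax - w (i + 2) ω j ≤ ℓ⟩
      have : r * inner ℝ u (y (i + 2) ω) ≤ r * (-(s / 8)) :=
        mul_le_mul_of_nonneg_left (by linarith) hr0.le
      linarith [hc.2]
  have hp2 : 0 ≤ 2 ^ N * (1 - p / 2) ^ n := mul_nonneg (by positivity) (pow_nonneg (by linarith) _)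
  have hq2 : 0 ≤ (1 - q) ^ N := pow_nonneg (by linarith) _
  calc _ ≤ μ.real ((⋃ v ∈ V, E v) ∪ ⋃ j ∈ (Finset.univ : Finset (Fin nx)), ⋃ v ∈ V, S j v) :=
        ENNReal.toReal_mono (measure_ne_top _ _) (measure_mono_ae hsub)
    _ ≤ μ.real (⋃ v ∈ V, E v) + μ.real (⋃ j ∈ (Finset.univ : Finset (Fin nx)), ⋃ v ∈ V, S j v) :=
        measureReal_union_le _ _
    _ ≤ V.card * (2 ^ N * (1 - p / 2) ^ n) + nx * (V.card * (1 - q) ^ N) := by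
        refine add_le_add ?_ ?_
        · refine (measureReal_biUnion_finset_le V E).trans ((Finset.sum_le_sum hE).trans_eq ?_)
          rw [Finset.sum_const, nsmul_eq_mul]
        · refine (measureReal_biUnion_finset_le Finset.univ fun j => ⋃ v ∈ V, S j v).trans
            ((Finset.sum_le_sum fun j _ => (measureReal_biUnion_finset_le V (S j)).trans
              (Finset.sum_le_sum fun v _ => hS j v)).trans_eq ?_)
          simp
    _ ≤ _ := by
        rw [mul_assoc (nx : ℝ)]
        gcongr

end Diameter

/-! ### Choosing the number of excitations: tail bound and rate. -/

section Rates

/-- Elementary tail estimate for the number of excited time steps. -/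
theorem two_pow_mul_one_sub_pow_le {p : ℝ} (hp1 : p < 1) (n N : ℕ) :
    2 ^ N * (1 - p / 2) ^ n ≤ Real.exp (N - p / 2 * n) := by
  have h1 : (2 : ℝ) ^ N ≤ Real.exp N := by
    rw [← Real.exp_one_pow]
    exact pow_le_pow_left₀ (by norm_num) (by linarith [Real.exp_one_gt_d9]) N
  have h2 : (1 - p / 2) ^ n ≤ Real.exp (-(p / 2 * n)) := by
    calc (1 - p / 2) ^ n ≤ Real.exp (-(p / 2)) ^ n :=
          pow_le_pow_left₀ (by linarith) (Real.one_sub_le_exp_neg _) n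
      _ = _ := by rw [← Real.exp_nat_mul]; congr 1; ring
  rw [sub_eq_add_neg (N : ℝ), Real.exp_add]
  exact mul_le_mul h1 h2 (pow_nonneg (by linarith) _) (Real.exp_nonneg _)

/-- The horizon contains at least `N - 1` blocks of length `m`, each worth `p m / 2 ≥ 1` in the
exponent. All but one of these blocks cancel the growth `2 ^ N` up to a constant, and the remaining
one supplies the decay in `m`. -/
theorem two_pow_ceil_mul_one_sub_pow_le {p : ℝ} (hp : 0 < p) (hp1 : p < 1) {m n : ℕ} (hm : 1 ≤ m)
    (hmn : m < n + 2) (hpm : 2 ≤ p * m) :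
    2 ^ ⌈((n + 2 : ℕ) : ℝ) / m⌉₊ * (1 - p / 2) ^ n ≤ 544 * Real.exp (-smeA3 p * m) := by
  set N := ⌈((n + 2 : ℕ) : ℝ) / m⌉₊ with hN
  have hm0 : (0 : ℝ) < m := by exact_mod_cast hm
  have hN1 : (1 : ℝ) < ((n + 2 : ℕ) : ℝ) / m := (one_lt_div hm0).2 (by exact_mod_cast hmn)
  have hN2 : 2 ≤ N := Nat.lt_ceil.2 (by exact_mod_cast hN1)
  have hN2' : (2 : ℝ) ≤ N := by exact_mod_cast hN2
  have hlt : ((N : ℝ) - 1) * m < n + 2 := by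
    have := Nat.ceil_lt_add_one (a := ((n + 2 : ℕ) : ℝ) / m) (by positivity)
    rw [← hN, ← sub_lt_iff_lt_add, lt_div_iff₀ hm0] at this
    push_cast at this
    exact this
  have hnat : (N - 1) * m + 1 ≤ n + 2 := by
    have : (((N - 1) * m : ℕ) : ℝ) < ((n + 2 : ℕ) : ℝ) := by
      rw [Nat.cast_mul, Nat.cast_sub (by omega)]
      push_cast
      exact hlt
    exact_mod_cast this
  have hn : ((N : ℝ) - 1) * m + 1 ≤ n + 2 := by
    have : (((N - 1) * m + 1 : ℕ) : ℝ) ≤ ((n + 2 : ℕ) : ℝ) := by exact_mod_cast hnat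
    rw [Nat.cast_add, Nat.cast_mul, Nat.cast_sub (by omega)] at this
    push_cast at this
    exact this
  refine (two_pow_mul_one_sub_pow_le hp1 n N).trans ?_
  have h1 : (N : ℝ) - p / 2 * n ≤ 3 + -smeA3 p * m := by
    have e1 : p / 2 * (((N : ℝ) - 1) * m - 1) ≤ p / 2 * n :=
      mul_le_mul_of_nonneg_left (by linarith) (by linarith)
    -- Expanded, this gives `N - (N - 1) p m / 2 ≤ 2 - p m / 2`; the lost steps cost at most `p / 2`
    -- more.
    have e2 : 0 ≤ ((N : ℝ) - 2) * (p * m / 2 - 1) :=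
      mul_nonneg (by linarith) (by linarith)
    have e3 : p * (p * m) ≤ 1 * (p * m) := mul_le_mul_of_nonneg_right hp1.le (by linarith)
    simp only [smeA3]
    nlinarith
  refine (Real.exp_le_exp.2 h1).trans ?_
  rw [Real.exp_add]
  refine mul_le_mul_of_nonneg_right ?_ (Real.exp_nonneg _)
  have : Real.exp 3 = Real.exp 1 ^ 3 := by rw [← Real.exp_nat_mul]; norm_num
  rw [this]
  calc Real.exp 1 ^ 3 ≤ 3 ^ 3 :=
        pow_le_pow_left₀ (Real.exp_nonneg _) (by linarith [Real.exp_one_lt_d9]) 3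
    _ ≤ 544 := by norm_num

theorem one_le_log_of_three_le {a : ℝ} (ha : 3 ≤ a) : 1 ≤ Real.log a := by
  rw [Real.le_log_iff_exp_le (by linarith)]
  linarith [Real.exp_one_lt_d9]

open scoped Matrix.Norms.Frobenius in
theorem frobDiam_eq_zero {n k : ℕ} (h : n = 0 ∨ k = 0) (S : Set (Matrix (Fin n) (Fin k) ℝ)) :
    frobDiam S = 0 := by
  refine Metric.ediam_subsingleton fun a _ c _ => ?_
  ext i j
  rcases h with rfl | rfl
  · exact i.elim0
  · exact j.elim0

section Constants

variable {s p b : ℝ}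

theorem four_mul_div_le_smeA2 (hs : 0 < s) (hp : 0 < p) (hp1 : p < 1) (hsb : s ≤ b) :
    4 * b / s ≤ smeA2 s p b := by
  have hb : 0 < b := hs.trans_le hsb
  have h1 : 1 ≤ b / (s * p) := (one_le_div (by positivity)).2
    ((mul_le_of_le_one_right hs.le hp1.le).trans hsb)
  have h2 : b / s ≤ b / (s * p) :=
    div_le_div_of_nonneg_left hb.le (by positivity) (mul_le_of_le_one_right hs.le hp1.le)
  have h3 : smeA2 s p b = 64 * (b / (s * p)) ^ 2 := by rw [smeA2]; field_simp
  rw [h3, mul_div_assoc]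
  nlinarith

theorem sixtyfour_le_smeA2 (hs : 0 < s) (hp : 0 < p) (hp1 : p < 1) (hsb : s ≤ b) :
    64 ≤ smeA2 s p b := by
  have h1 : 1 ≤ b / (s * p) := (one_le_div (by positivity)).2
    ((mul_le_of_le_one_right hs.le hp1.le).trans hsb)
  have h3 : smeA2 s p b = 64 * (b / (s * p)) ^ 2 := by rw [smeA2]; field_simp
  rw [h3]
  nlinarith

theorem four_mul_div_le_smeA4 {n : ℕ} (hn : 0 < n) (hs : 0 < s) (hp : 0 < p) (hp1 : p < 1)
    (hsb : s ≤ b) : 4 * b / s ≤ smeA4 n s p b ∧ 16 ≤ smeA4 n s p b := by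
  have hb : 0 < b := hs.trans_le hsb
  have h1 : 1 ≤ b / (s * p) := (one_le_div (by positivity)).2
    ((mul_le_of_le_one_right hs.le hp1.le).trans hsb)
  have h2 : b / s ≤ b / (s * p) :=
    div_le_div_of_nonneg_left hb.le (by positivity) (mul_le_of_le_one_right hs.le hp1.le)
  have h3 : smeA4 n s p b = 16 * (b / (s * p)) * √(n : ℝ) := by rw [smeA4]; ring
  have h4 : 1 ≤ √(n : ℝ) := Real.one_le_sqrt.2 (by exact_mod_cast hn)
  have h5 : 16 * (b / (s * p)) ≤ smeA4 n s p b := by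
    rw [h3]; exact le_mul_of_one_le_right (by positivity) h4
  rw [mul_div_assoc]
  constructor <;> linarith

end Constants

/-- The lower bound on the block length makes the horizon long compared with the size of the net. -/
theorem horizon_lower_bound {s p b ε : ℝ} {k m T : ℕ} (hk : 0 < k) (hs : 0 < s) (hp : 0 < p)
    (hp1 : p < 1) (hsb : s ≤ b) (hε : 0 < ε) (hε2 : ε < 1 / 2) (hmT : m ≤ T)
    (hm : (1 / smeA3 p) * (Real.log (T / ε) + k * Real.log (smeA2 s p b)
      + 5 / 2 * Real.log k + Real.log (Real.log (smeA2 s p b * k)) + Real.log 544) ≤ m) :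
    1 ≤ T ∧ 2 * (Real.log (1 / ε) + k * Real.log (4 * b / s) + 2) ≤ p * T / 4 := by
  have hb0 : 0 < b := hs.trans_le hsb
  have hk1 : (1 : ℝ) ≤ k := by exact_mod_cast hk
  have ha2 := sixtyfour_le_smeA2 hs hp hp1 hsb
  have hlog544 : 2 ≤ Real.log 544 := by
    rw [Real.le_log_iff_exp_le (by norm_num)]
    have : Real.exp 2 = Real.exp 1 ^ 2 := by rw [← Real.exp_nat_mul]; norm_num
    rw [this]
    calc Real.exp 1 ^ 2 ≤ 3 ^ 2 :=
          pow_le_pow_left₀ (Real.exp_nonneg _) (by linarith [Real.exp_one_lt_d9]) 2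
      _ ≤ 544 := by norm_num
  have hloglog : 0 ≤ Real.log (Real.log (smeA2 s p b * k)) :=
    Real.log_nonneg (one_le_log_of_three_le (by nlinarith))
  have hT1 : 1 ≤ T := by
    by_contra! h0
    have hT0 : T = 0 := by omega
    have hm0 : m = 0 := by omega
    subst hT0 hm0
    -- At `T = 0` the logarithm of `T / ε` takes the default value `0`, so a positive quantity would
    -- be at most `m = 0`.
    simp only [Nat.cast_zero, zero_div, Real.log_zero, zero_add] at hm
    have h1 : 0 ≤ k * Real.log (smeA2 s p b) :=
      mul_nonneg (by linarith) (Real.log_nonneg (by linarith))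
    have h2 : 0 ≤ Real.log k := Real.log_nonneg hk1
    have h3 : 0 < 1 / smeA3 p := by simp only [smeA3]; positivity
    have := mul_pos h3 (show 0 < k * Real.log (smeA2 s p b) + 5 / 2 * Real.log k +
      Real.log (Real.log (smeA2 s p b * k)) + Real.log 544 by linarith)
    linarith
  have hT1' : (1 : ℝ) ≤ T := by exact_mod_cast hT1
  refine ⟨hT1, ?_⟩
  have h1 : Real.log (1 / ε) + k * Real.log (4 * b / s) + 2 ≤ Real.log (T / ε)
      + k * Real.log (smeA2 s p b) + 5 / 2 * Real.log k
      + Real.log (Real.log (smeA2 s p b * k)) + Real.log 544 := by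
    have e1 : Real.log (1 / ε) ≤ Real.log (T / ε) := Real.log_le_log (by positivity) (by gcongr)
    have e2 : k * Real.log (4 * b / s) ≤ k * Real.log (smeA2 s p b) :=
      mul_le_mul_of_nonneg_left (Real.log_le_log (by positivity)
        (four_mul_div_le_smeA2 hs hp hp1 hsb)) (by linarith)
    have e3 : 0 ≤ Real.log k := Real.log_nonneg hk1
    linarith
  have h0 : 0 ≤ Real.log (1 / ε) + k * Real.log (4 * b / s) + 2 := by
    have : 0 ≤ k * Real.log (4 * b / s) := mul_nonneg (by linarith) (Real.log_nonneg (by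
      rw [le_div_iff₀ hs]; linarith))
    have := Real.log_nonneg (show 1 ≤ 1 / ε by rw [le_div_iff₀ hε]; linarith)
    linarith
  have h3 : 1 / smeA3 p = 8 / p ^ 2 := by rw [smeA3]; field_simp
  have h4 : 8 / p ^ 2 * (Real.log (1 / ε) + k * Real.log (4 * b / s) + 2) ≤ T := by
    rw [h3] at hm
    exact (mul_le_mul_of_nonneg_left h1 (by positivity)).trans
      (hm.trans (by exact_mod_cast hmT))
  have h5 : 8 * (Real.log (1 / ε) + k * Real.log (4 * b / s) + 2) ≤ T * p ^ 2 := by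
    rw [div_mul_eq_mul_div, div_le_iff₀ (by positivity)] at h4
    exact h4
  have h6 : T * p ^ 2 ≤ T * p := mul_le_mul_of_nonneg_left (by nlinarith) (by linarith)
  linarith

/-- The logarithm of the size of the net is controlled by the terms of the rate. -/
theorem log_net_le {s p b Λ : ℝ} {n k : ℕ} (hn : 0 < n) (hk : 0 < k) (hs : 0 < s) (hp : 0 < p)
    (hp1 : p < 1) (hsb : s ≤ b) (hdim : k * (s ^ 2 * p) ≤ b ^ 2) (hΛ : Real.log 2 ≤ Λ) :
    Real.log n + k * Real.log (4 * b / s) ≤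
      2 * Λ + 6 * (n * k * Real.log (b * n / (s * p))) := by
  have hb0 : 0 < b := hs.trans_le hsb
  have hk1 : (1 : ℝ) ≤ k := by exact_mod_cast hk
  have hn1 : (1 : ℝ) ≤ n := by exact_mod_cast hn
  have hbsp : 1 ≤ b / (s * p) := (one_le_div (by positivity)).2
    ((mul_le_of_le_one_right hs.le hp1.le).trans hsb)
  have hlog2 : 0 < Real.log 2 := Real.log_pos (by norm_num)
  set L := Real.log (b * n / (s * p)) with hL
  have hLeq : L = Real.log (b / (s * p)) + Real.log n := by
    rw [hL, ← Real.log_mul (by positivity) (by positivity)]; congr 1; ring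
  have hlogbsp : 0 ≤ Real.log (b / (s * p)) := Real.log_nonneg hbsp
  have hlogn : 0 ≤ Real.log n := Real.log_nonneg hn1
  have hL0 : 0 ≤ L := by linarith
  have e1 : Real.log (4 * b / s) = 2 * Real.log 2 + Real.log (b / s) := by
    rw [mul_div_assoc, Real.log_mul (by norm_num) (by positivity)]
    congr 1
    rw [show (4 : ℝ) = 2 ^ 2 by norm_num, Real.log_pow]; norm_num
  have e2 : Real.log (b / s) ≤ L := by
    have : Real.log (b / s) ≤ Real.log (b / (s * p)) := Real.log_le_log (by positivity)
      (div_le_div_of_nonneg_left hb0.le (by positivity) (mul_le_of_le_one_right hs.le hp1.le))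
    linarith
  have e3 : L ≤ k * L := le_mul_of_one_le_left hL0 hk1
  have e4 : k * L ≤ n * k * L := by
    rw [mul_assoc]; exact le_mul_of_one_le_left (by positivity) hn1
  -- `L` may be arbitrarily small, so it cannot always absorb `log 2`. For `k = 1` the term `Λ`
  -- does. For `k ≥ 2` the dimension bound forces `(b / (s p)) ^ 2 ≥ 2`, hence `log 2 ≤ 2 L`.
  have e5 : k * (2 * Real.log 2) ≤ 2 * Λ + 4 * (k * L) := by
    rcases Nat.lt_or_ge k 2 with h1 | h2
    · have : k = 1 := by omega
      rw [this]; push_cast; linarith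
    · have h2' : (2 : ℝ) ≤ k := by exact_mod_cast h2
      have h3 : (2 : ℝ) ≤ (b / (s * p)) ^ 2 := by
        rw [div_pow, le_div_iff₀ (by positivity)]
        have : 2 * (s ^ 2 * p) ≤ k * (s ^ 2 * p) :=
          mul_le_mul_of_nonneg_right h2' (by positivity)
        have h4 : s ^ 2 * p * p ≤ s ^ 2 * p * 1 :=
          mul_le_mul_of_nonneg_left hp1.le (by positivity)
        nlinarith
      have h4 := Real.log_le_log (by norm_num) h3
      rw [Real.log_pow] at h4
      push_cast at h4
      have h5 : 2 * Real.log 2 ≤ 4 * L := by linarith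
      have := mul_le_mul_of_nonneg_left h5 (by linarith : (0 : ℝ) ≤ k)
      linarith
  have e6 : k * Real.log (b / s) ≤ k * L := mul_le_mul_of_nonneg_left e2 (by linarith)
  rw [e1, mul_add]
  linarith

variable {Ω : Type*} [mΩ : MeasurableSpace Ω] {μ : Measure Ω} [IsProbabilityMeasure μ]
  {nx nu nφ : ℕ} {θ : Matrix (Fin nx) (Fin nφ) ℝ} {φ : Vec nx × Vec nu → Vec nφ}
  {π : Vec nx → Vec nu} {w : ℕ → Ω → Vec nx} {η : ℕ → Ω → Vec nu} {x : ℕ → Ω → Vec nx}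
  {wmax umax ρx ρ : ℝ} {qw : ℝ → ℝ}

/-- The non-asymptotic diameter bound of the set-membership estimate. -/
theorem IsClosedLoopSystem.measureReal_lt_frobDiam_le_exp
    (h : IsClosedLoopSystem μ θ φ π w η x wmax umax ρx ρ qw)
    {s p b : ℝ} (hs : 0 < s) (hp : 0 < p) (hp1 : p < 1)
    (hB : IsBMSB μ (history π w η x) (features φ π η x) 1
      ((s ^ 2) • (1 : Matrix (Fin nφ) (Fin nφ) ℝ)) p)
    (hb : ∀ t, ∀ᵐ ω ∂μ, ‖features φ π η x t ω‖ ≤ b) {m T : ℕ} {δ : ℝ} (hm : 1 ≤ m) (hmT : m < T)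
    (hδ : 0 < δ) :
    μ.real {ω | ENNReal.ofReal δ < frobDiam (smeSet wmax x (features φ π η x) T ω)} ≤
      544 * ((T : ℝ) / m) * (nφ : ℝ) ^ (5 / 2 : ℝ) * Real.log (smeA2 s p b * nφ)
          * smeA2 s p b ^ nφ * Real.exp (-smeA3 p * m)
        + 544 * (nx : ℝ) ^ (5 / 2 : ℝ) * (nφ : ℝ) ^ (5 / 2 : ℝ)
          * Real.log (smeA4 nx s p b * nx * nφ) * smeA4 nx s p b ^ (nx * nφ)
          * (1 - qw (smeA1 s p * δ / (4 * √(nx : ℝ)))) ^ ⌈(T : ℝ) / m⌉₊ := by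
  have hm0 : (0 : ℝ) < m := by exact_mod_cast hm
  rcases Nat.eq_zero_or_pos nφ with hnφ | hnφ
  · simp [frobDiam_eq_zero (Or.inr hnφ), hnφ]
  have hsb : s ≤ b := hB.le_bound hnφ hs hp (hb 2)
  have hb0 : 0 < b := hs.trans_le hsb
  have hnφ1 : (1 : ℝ) ≤ nφ := by exact_mod_cast hnφ
  have hTm : 1 ≤ (T : ℝ) / m := (one_le_div hm0).2 (by exact_mod_cast hmT.le)
  have ha2 := sixtyfour_le_smeA2 hs hp hp1 hsb
  have hpow : 1 ≤ (nφ : ℝ) ^ (5 / 2 : ℝ) := Real.one_le_rpow hnφ1 (by norm_num)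
  have hlog : 1 ≤ Real.log (smeA2 s p b * nφ) := one_le_log_of_three_le (by nlinarith)
  have hK0 : 0 ≤ (4 * b / s) ^ nφ := by positivity
  have hfirst : smeA2 s p b ^ nφ * (544 * Real.exp (-smeA3 p * m)) ≤
      544 * ((T : ℝ) / m) * (nφ : ℝ) ^ (5 / 2 : ℝ) * Real.log (smeA2 s p b * nφ)
          * smeA2 s p b ^ nφ * Real.exp (-smeA3 p * m) := by
    have h1 : 1 ≤ (T : ℝ) / m * (nφ : ℝ) ^ (5 / 2 : ℝ) * Real.log (smeA2 s p b * nφ) :=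
      one_le_mul_of_one_le_of_one_le (one_le_mul_of_one_le_of_one_le hTm hpow) hlog
    have h2 : 0 ≤ smeA2 s p b ^ nφ * (544 * Real.exp (-smeA3 p * m)) := by positivity
    exact (le_mul_of_one_le_left h2 h1).trans_eq (by ring)
  rcases Nat.eq_zero_or_pos nx with hnx | hnx
  · simp only [frobDiam_eq_zero (Or.inl hnx)]
    simp only [hnx]
    refine le_trans ?_ (add_le_add hfirst le_rfl)
    simp
    positivity
  have hnx1 : (1 : ℝ) ≤ nx := by exact_mod_cast hnx
  have hsq : 0 < √(nx : ℝ) := Real.sqrt_pos.2 (by linarith)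
  set ℓ := smeA1 s p * δ / (4 * √(nx : ℝ)) with hℓdef
  -- The extra factor `p < 1` supplies the strict inequality that the union bound needs.
  have hℓeq : ℓ = p * (s * δ / (16 * √(nx : ℝ))) := by rw [hℓdef, smeA1]; field_simp; norm_num
  have hℓ0 : 0 < ℓ := by rw [hℓeq]; positivity
  have hℓ : ℓ < s * δ / (16 * √(nx : ℝ)) := by
    rw [hℓeq]; exact mul_lt_of_lt_one_left (by positivity) hp1
  obtain ⟨hq0, hq⟩ := h.tight ℓ hℓ0
  have hq1 : qw ℓ ≤ 1 := (hq ⟨0, hnx⟩ 0).1.trans measureReal_le_one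
  obtain ⟨ha4, ha4'⟩ := four_mul_div_le_smeA4 hnx hs hp hp1 hsb
  have hq2 : 0 ≤ (1 - qw ℓ) ^ ⌈(T : ℝ) / m⌉₊ := pow_nonneg (by linarith) _
  have hsecond : nx * (4 * b / s) ^ nφ * (1 - qw ℓ) ^ ⌈(T : ℝ) / m⌉₊ ≤
      544 * (nx : ℝ) ^ (5 / 2 : ℝ) * (nφ : ℝ) ^ (5 / 2 : ℝ)
          * Real.log (smeA4 nx s p b * nx * nφ) * smeA4 nx s p b ^ (nx * nφ)
          * (1 - qw ℓ) ^ ⌈(T : ℝ) / m⌉₊ := by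
    refine mul_le_mul_of_nonneg_right ?_ hq2
    have h1 : (4 * b / s) ^ nφ ≤ smeA4 nx s p b ^ (nx * nφ) :=
      (pow_le_pow_left₀ (by positivity) ha4 _).trans
        (pow_le_pow_right₀ (by linarith) (Nat.le_mul_of_pos_left _ hnx))
    have h2 : 16 ≤ smeA4 nx s p b * nx * nφ := by
      calc (16 : ℝ) = 16 * 1 * 1 := by norm_num
        _ ≤ _ := by gcongr
    have h3 : 1 ≤ Real.log (smeA4 nx s p b * nx * nφ) := one_le_log_of_three_le (by linarith)
    have h4 : (nx : ℝ) ≤ 544 * (nx : ℝ) ^ (5 / 2 : ℝ) := by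
      have : (nx : ℝ) ^ (1 : ℝ) ≤ (nx : ℝ) ^ (5 / 2 : ℝ) :=
        Real.rpow_le_rpow_of_exponent_le hnx1 (by norm_num)
      rw [Real.rpow_one] at this
      linarith
    calc nx * (4 * b / s) ^ nφ = nx * 1 * 1 * (4 * b / s) ^ nφ := by ring
      _ ≤ _ := by gcongr
  -- For short blocks, `p m < 2`, the exponent `a₃ m` is at most `1 / 4` and the claimed bound
  -- exceeds `1`.
  rcases le_or_gt 2 (p * m) with hpm | hpm
  · obtain ⟨n, rfl⟩ : ∃ n, T = n + 2 := ⟨T - 2, by omega⟩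
    refine (h.measureReal_lt_frobDiam_le hnx hnφ hs hp hp1 hB hb hδ hℓ hq0.le hq1 hq n
      ⌈((n + 2 : ℕ) : ℝ) / m⌉₊).trans (add_le_add (le_trans ?_ hfirst) hsecond)
    exact mul_le_mul (pow_le_pow_left₀ (by positivity) (four_mul_div_le_smeA2 hs hp hp1 hsb) _)
      (two_pow_ceil_mul_one_sub_pow_le hp hp1 hm hmT hpm)
      (mul_nonneg (by positivity) (pow_nonneg (by linarith) _)) (by positivity)
  · refine le_trans measureReal_le_one (le_trans ?_ (le_add_of_nonneg_right
      (le_trans (by positivity) hsecond)))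
    refine le_trans ?_ hfirst
    have h1 : 1 ≤ smeA2 s p b ^ nφ := one_le_pow₀ (by linarith)
    have h2 : 1 ≤ 544 * Real.exp (-smeA3 p * m) := by
      have : p * (p * m) ≤ 1 * 2 := mul_le_mul hp1.le hpm.le (by positivity) (by norm_num)
      have h3 : -(1 / 4) ≤ -smeA3 p * m := by simp only [smeA3]; linarith
      have h4 := Real.add_one_le_exp (-smeA3 p * m)
      linarith
    exact one_le_mul_of_one_le_of_one_le h1 h2

/-- A linear tightness profile, capped at one, bounds the tail probabilities from below. -/
theorem IsClosedLoopSystem.min_mul_le_measureReal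
    (h : IsClosedLoopSystem μ θ φ π w η x wmax umax ρx ρ qw) {cw : ℝ}
    (hqw : ∀ ℓ : ℝ, 0 < ℓ → ℓ ≤ 2 * wmax → qw ℓ = cw * ℓ) {ℓ : ℝ} (hℓ0 : 0 < ℓ) (j : Fin nx)
    (t : ℕ) : min (cw * ℓ) 1 ≤ μ.real {ω | w t ω j + wmax ≤ ℓ} ∧
      min (cw * ℓ) 1 ≤ μ.real {ω | wmax - w t ω j ≤ ℓ} := by
  rcases le_or_gt ℓ (2 * wmax) with hle | hgt
  · have := (h.tight ℓ hℓ0).2 j t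
    rw [hqw ℓ hℓ0 hle] at this
    exact ⟨(min_le_left _ _).trans this.1, (min_le_left _ _).trans this.2⟩
  -- For `ℓ > 2 wmax` the linear formula is not assumed, but both events are almost sure; hence the
  -- cap at `1`.
  · have hone : ∀ A : Set Ω, (∀ᵐ ω ∂μ, ω ∈ A) → min (cw * ℓ) 1 ≤ μ.real A := fun A hA => by
      have : μ A = 1 := by
        rw [← measure_univ (μ := μ)]
        exact measure_congr (eventuallyEq_univ.2 hA)
      rw [measureReal_def, this, ENNReal.toReal_one]
      exact min_le_right _ _
    have hw : ∀ᵐ ω ∂μ, |w t ω j| ≤ wmax := (h.disturbance.bounded t).mono fun ω hω =>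
      (abs_apply_le_linfNorm (w t ω) j).trans hω
    refine ⟨hone _ (hw.mono fun ω hω => ?_), hone _ (hw.mono fun ω hω => ?_)⟩
    · show w t ω j + wmax ≤ ℓ
      linarith [(abs_le.1 hω).2]
    · show wmax - w t ω j ≤ ℓ
      linarith [(abs_le.1 hω).1]

/-- The rate of convergence of the set-membership estimate under a linear tightness profile. -/
theorem IsClosedLoopSystem.le_measureReal_frobDiam_le
    (h : IsClosedLoopSystem μ θ φ π w η x wmax umax ρx ρ qw)
    {s p b : ℝ} (hs : 0 < s) (hp : 0 < p) (hp1 : p < 1)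
    (hB : IsBMSB μ (history π w η x) (features φ π η x) 1
      ((s ^ 2) • (1 : Matrix (Fin nφ) (Fin nφ) ℝ)) p)
    (hb : ∀ t, ∀ᵐ ω ∂μ, ‖features φ π η x t ω‖ ≤ b) {cw : ℝ} (hcw : 0 < cw)
    (hqw : ∀ ℓ : ℝ, 0 < ℓ → ℓ ≤ 2 * wmax → qw ℓ = cw * ℓ) {ε : ℝ} {m T : ℕ} (hε : 0 < ε)
    (hmT : m ≤ T)
    (hm : (1 / smeA3 p) * (Real.log (T / ε) + nφ * Real.log (smeA2 s p b)
      + 5 / 2 * Real.log nφ + Real.log (Real.log (smeA2 s p b * nφ)) + Real.log 544) ≤ m) :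
    1 - 2 * ε ≤ μ.real {ω | frobDiam (smeSet wmax x (features φ π η x) T ω) ≤
      ENNReal.ofReal (768 * ((√(nx : ℝ) * Real.log (1 / ε)
        + (nx : ℝ) ^ (3 / 2 : ℝ) * nφ * Real.log (b * nx / (s * p))) / (cw * s * p * T)))} := by
  by_cases hzero : nx = 0 ∨ nφ = 0
  · simp only [frobDiam_eq_zero hzero, zero_le, Set.ofPred_true, probReal_univ]
    linarith
  rw [not_or] at hzero
  have hnx := Nat.pos_of_ne_zero hzero.1
  have hnφ := Nat.pos_of_ne_zero hzero.2
  rcases le_or_gt (1 / 2) ε with hε2 | hε2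
  · exact le_trans (by linarith) measureReal_nonneg
  have hsb : s ≤ b := hB.le_bound hnφ hs hp (hb 2)
  have hb0 : 0 < b := hs.trans_le hsb
  have hnφ1 : (1 : ℝ) ≤ nφ := by exact_mod_cast hnφ
  have hnx1 : (1 : ℝ) ≤ nx := by exact_mod_cast hnx
  have ha2 := sixtyfour_le_smeA2 hs hp hp1 hsb
  have hbsp : 1 ≤ b / (s * p) := (one_le_div (by positivity)).2
    ((mul_le_of_le_one_right hs.le hp1.le).trans hsb)
  have hsq : 0 < √(nx : ℝ) := Real.sqrt_pos.2 (by linarith)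
  set Λ := Real.log (1 / ε) with hΛ
  have hΛ2 : Real.log 2 ≤ Λ := Real.log_le_log (by norm_num) (by
    rw [le_div_iff₀ hε]; linarith)
  have hlog2 : 0 < Real.log 2 := Real.log_pos (by norm_num)
  set L := Real.log (b * nx / (s * p)) with hL
  have hL0 : 0 ≤ L := Real.log_nonneg (by
    rw [mul_div_right_comm]; exact one_le_mul_of_one_le_of_one_le hbsp hnx1)
  have hK : Real.log ((4 * b / s) ^ nφ) = nφ * Real.log (4 * b / s) := Real.log_pow _ _
  have hK0 : 0 < (4 * b / s) ^ nφ := by positivity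
  obtain ⟨hT1, hTlow⟩ := horizon_lower_bound hnφ hs hp hp1 hsb hε hε2 hmT hm
  have hT1' : (1 : ℝ) ≤ T := by exact_mod_cast hT1
  have hlogK0 : 0 ≤ nφ * Real.log (4 * b / s) := mul_nonneg (by linarith) (Real.log_nonneg (by
    rw [le_div_iff₀ hs]; linarith))
  have hT2 : 2 ≤ T := by
    have : (2 : ℝ) ≤ T := by nlinarith
    exact_mod_cast this
  obtain ⟨n, hn⟩ : ∃ n, T = n + 2 := ⟨T - 2, by omega⟩
  -- Half of the guaranteed excitation exponent `p T / 2`: the remaining `p T / 4` dominates `log (1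
  -- / ε)`, the net and the rounding errors.
  set N := ⌈p * T / 4⌉₊ with hN
  have hNle : (N : ℝ) < p * T / 4 + 1 := Nat.ceil_lt_add_one (by positivity)
  have hNge : p * T / 4 ≤ N := Nat.le_ceil _
  have hn' : (n : ℝ) = T - 2 := by rw [hn]; push_cast; ring
  have hbad1 : (4 * b / s) ^ nφ * (2 ^ N * (1 - p / 2) ^ n) ≤ ε := by
    calc _ ≤ (4 * b / s) ^ nφ * Real.exp (N - p / 2 * n) :=
          mul_le_mul_of_nonneg_left (two_pow_mul_one_sub_pow_le hp1 n N) hK0.le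
      _ = Real.exp (nφ * Real.log (4 * b / s) + (N - p / 2 * n)) := by
          rw [Real.exp_add, ← hK, Real.exp_log hK0]
      _ ≤ Real.exp (-Λ) := by
          refine Real.exp_le_exp.2 ?_
          rw [hn']
          nlinarith
      _ = ε := by rw [hΛ, one_div, Real.log_inv, neg_neg, Real.exp_log hε]
  set D := 768 * ((√(nx : ℝ) * Λ + (nx : ℝ) ^ (3 / 2 : ℝ) * nφ * L) / (cw * s * p * T)) with hD
  have hD0 : 0 < D := by
    have : 0 < √(nx : ℝ) * Λ := mul_pos hsq (by linarith)
    positivity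
  -- Half of the admissible threshold. With `768 = 6 * 128`, the product `cw ℓ (p T / 4)` is exactly
  -- `6 (Λ + nx nφ L)`, which covers the net, the rows and one further `Λ`.
  set ℓ := s * D / (32 * √(nx : ℝ)) with hℓdef
  have hℓ0 : 0 < ℓ := by positivity
  have hℓ : ℓ < s * D / (16 * √(nx : ℝ)) :=
    div_lt_div_of_pos_left (by positivity) (by positivity) (by linarith)
  have hq := h.min_mul_le_measureReal hqw hℓ0
  have hexp : cw * ℓ * N ≥ 3 * Λ + 6 * (nx * nφ * L) := by
    have e1 : (nx : ℝ) ^ (3 / 2 : ℝ) = √(nx : ℝ) * nx := by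
      rw [Real.sqrt_eq_rpow, ← Real.rpow_add_one (by positivity)]; norm_num
    have e2 : cw * ℓ * (p * T / 4) = 6 * (Λ + nx * nφ * L) := by
      rw [hℓdef, hD, e1]
      field_simp
      ring
    have e3 : cw * ℓ * (p * T / 4) ≤ cw * ℓ * N := mul_le_mul_of_nonneg_left hNge (by positivity)
    linarith
  have hlogs := log_net_le hnx hnφ hs hp hp1 hsb (hB.dim_mul_le hs (hb 2)) hΛ2
  have hN1 : N ≠ 0 := by
    have : (0 : ℝ) < N := lt_of_lt_of_le (by positivity) hNge
    exact_mod_cast this.ne'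
  have hpowexp : (1 - min (cw * ℓ) 1) ^ N ≤ Real.exp (-(cw * ℓ * N)) := by
    rcases le_or_gt (cw * ℓ) 1 with hle | hgt
    · rw [min_eq_left hle]
      calc (1 - cw * ℓ) ^ N ≤ Real.exp (-(cw * ℓ)) ^ N :=
            pow_le_pow_left₀ (by linarith) (Real.one_sub_le_exp_neg _) N
        _ = _ := by rw [← Real.exp_nat_mul]; congr 1; ring
    · rw [min_eq_right hgt.le, sub_self, zero_pow hN1]
      exact Real.exp_nonneg _
  have hbad2 : nx * (4 * b / s) ^ nφ * (1 - min (cw * ℓ) 1) ^ N ≤ ε := by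
    calc _ ≤ nx * (4 * b / s) ^ nφ * Real.exp (-(cw * ℓ * N)) :=
          mul_le_mul_of_nonneg_left hpowexp (by positivity)
      _ = Real.exp (Real.log nx + nφ * Real.log (4 * b / s) + -(cw * ℓ * N)) := by
          rw [Real.exp_add, Real.exp_add, ← hK, Real.exp_log hK0, Real.exp_log (by linarith)]
      _ ≤ Real.exp (-Λ) := Real.exp_le_exp.2 (by linarith)
      _ = ε := by rw [hΛ, one_div, Real.log_inv, neg_neg, Real.exp_log hε]
  have hcore := h.measureReal_lt_frobDiam_le hnx hnφ hs hp hp1 hB hb hD0 hℓ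
    (q := min (cw * ℓ) 1) (le_min (by positivity) zero_le_one) (min_le_right _ _) hq n N
  rw [← hn] at hcore
  have hunion : 1 ≤ μ.real {ω | frobDiam (smeSet wmax x (features φ π η x) T ω) ≤
        ENNReal.ofReal D} +
      μ.real {ω | ENNReal.ofReal D < frobDiam (smeSet wmax x (features φ π η x) T ω)} := by
    rw [← probReal_univ (μ := μ)]
    refine le_trans (measureReal_mono fun ω _ => ?_) (measureReal_union_le _ _)
    exact le_or_gt (frobDiam (smeSet wmax x (features φ π η x) T ω)) (ENNReal.ofReal D)
  linarith

end Rates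

theorem corollary3 :
    -- an absolute constant, for the rate at the end
    ∃ C : ℝ, 0 < C ∧
    ∀ (nx nu nφ : ℕ) (Ω : Type*) [MeasurableSpace Ω] (μ : Measure Ω) [IsProbabilityMeasure μ]
      (θ : Matrix (Fin nx) (Fin nφ) ℝ) (φ : Vec nx × Vec nu → Vec nφ) (π : Vec nx → Vec nu)
      (w : ℕ → Ω → Vec nx) (η : ℕ → Ω → Vec nu) (x : ℕ → Ω → Vec nx)
      (wmax umax ρx ρ : ℝ) (qw : ℝ → ℝ),
      IsClosedLoopSystem μ θ φ π w η x wmax umax ρx ρ qw →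
      -- the small-ball constants exist
      (∃ s p : ℝ, 0 < s ∧ 0 < p ∧ p < 1 ∧
        IsBMSB μ (history π w η x) (features φ π η x) 1
          ((s ^ 2) • (1 : Matrix (Fin nφ) (Fin nφ) ℝ)) p) ∧
      -- the features are bounded
      (∃ b : ℝ, ∀ t, ∀ᵐ ω ∂μ, ‖features φ π η x t ω‖ ≤ b) ∧
      -- for all such constants, the diameter bound and the rate hold
      ∀ s p b : ℝ, 0 < s → 0 < p → p < 1 →
        IsBMSB μ (history π w η x) (features φ π η x) 1
          ((s ^ 2) • (1 : Matrix (Fin nφ) (Fin nφ) ℝ)) p →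
        (∀ t, ∀ᵐ ω ∂μ, ‖features φ π η x t ω‖ ≤ b) →
        (∀ (m T : ℕ) (δ : ℝ), 1 ≤ m → m < T → 0 < δ → δ < 1 →
          μ.real {ω | ENNReal.ofReal δ < frobDiam (smeSet wmax x (features φ π η x) T ω)} ≤
            544 * ((T : ℝ) / m) * (nφ : ℝ) ^ (5 / 2 : ℝ) * Real.log (smeA2 s p b * nφ)
                * smeA2 s p b ^ nφ * Real.exp (-smeA3 p * m)
              + 544 * (nx : ℝ) ^ (5 / 2 : ℝ) * (nφ : ℝ) ^ (5 / 2 : ℝ)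
                * Real.log (smeA4 nx s p b * nx * nφ) * smeA4 nx s p b ^ (nx * nφ)
                * (1 - qw (smeA1 s p * δ / (4 * √(nx : ℝ)))) ^ ⌈(T : ℝ) / m⌉₊) ∧
        (∀ (cw : ℝ), 0 < cw → (∀ ℓ : ℝ, 0 < ℓ → ℓ ≤ 2 * wmax → qw ℓ = cw * ℓ) →
          ∀ (ε : ℝ) (m T : ℕ), 0 < ε → 1 ≤ m → m ≤ T →
            (1 / smeA3 p) * (Real.log (T / ε) + nφ * Real.log (smeA2 s p b)
              + 5 / 2 * Real.log nφ + Real.log (Real.log (smeA2 s p b * nφ))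
              + Real.log 544) ≤ m →
            1 - 2 * ε ≤ μ.real {ω | frobDiam (smeSet wmax x (features φ π η x) T ω) ≤
              ENNReal.ofReal (C * ((√(nx : ℝ) * Real.log (1 / ε)
                + (nx : ℝ) ^ (3 / 2 : ℝ) * nφ * Real.log (b * nx / (s * p)))
                / (cw * s * p * T)))}) := by
  refine ⟨768, by norm_num, ?_⟩
  intro nx nu nφ Ω _ μ _ θ φ π w η x wmax umax ρx ρ qw h
  refine ⟨h.exists_isBMSB, h.exists_features_bound, fun s p b hs hp hp1 hB hb => ⟨?_, ?_⟩⟩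
  · intro m T δ hm hmT hδ _
    exact h.measureReal_lt_frobDiam_le_exp hs hp hp1 hB hb hm hmT hδ
  · intro cw hcw hqw ε m T hε _ hmT hcond
    exact h.le_measureReal_frobDiam_le hs hp hp1 hB hb hcw hqw hε hmT hcond
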